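/- Let $d,d',T\ge 1$ be integers, $A\in\mathbb R^{d\times d}$ nonsingular, $B\in\mathbb R^{d\times d'}$, $\gamma,c_\alpha,c_\beta>0$, $m_\alpha,m_\beta\in\mathbb R^d$, and $\Sigma_\alpha,\Sigma_\beta\succ0$. Put $\alpha=c_\alpha\mathcal N(m_\alpha,\Sigma_\alpha)$, $\beta=c_\beta\mathcal N(m_\beta,\Sigma_\beta)$. For finite measures let $\mathrm{KL}(\mu\|\nu)=\int\log\frac{d\mu}{d\nu}\,d\mu-\mu(\mathbb R^d)+\nu(\mathbb R^d)$ if $\mu\ll\nu$ and $+\infty$ otherwise. **UDC problem.** Over pairs $(\pi_1,\{U_t\}_{t=1}^{T-1})$ of a finite nonnegative measure $\pi_1$ on $\mathbb R^d$ and Markov kernels $U_t(du\mid x)$ from $\mathbb R^d$ to $\mathbb R^{d'}$, with $\pi_{t+1}$ the image of $\pi_t(dx)\,U_t(du\mid x)$ under $(x,u)\mapsto Ax+Bu$, such that every $\pi_t$ ($1\le t\le T$) is finite with finite second moment and $\sum_{t=1}^{T-1}\int\!\int\|u\|^2U_t(du\mid x)\pi_t(dx)<\infty$, minimize $$J(\pi_1,\{U_t\})=\sum_{t=1}^{T-1}\int\!\!\int\|u\|^2\,U_t(du\mid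 x)\,\pi_t(dx)+\gamma\,\mathrm{KL}(\pi_1\|\alpha)+\gamma\,\mathrm{KL}(\pi_T\|\beta).$$ **Lifted SDP.** Let $p^\star$ be the infimum of $$\sum_{t=1}^{T-1}\bigl(\|v_t\|^2+\operatorname{tr}Y_t\bigr)+\tfrac{\gamma}{2}\Bigl[(m_1-m_\alpha)^\top\Sigma_\alpha^{-1}(m_1-m_\alpha)+(m_T-m_\beta)^\top\Sigma_\beta^{-1}(m_T-m_\beta)+\operatorname{tr}(\Sigma_\alpha^{-1}\Sigma_1)+\operatorname{tr}(\Sigma_\beta^{-1}\Sigma_T)-\log\det\Sigma_1-\log\det\Sigma_T\Bigr]$$ (with $-\log\det=+\infty$ on singular positive semidefinite matrices) over $\{m_t,\Sigma_t\}_{t=1}^T$, $\{v_t,S_t,Y_t\}_{t=1}^{T-1}$ with $\Sigma_t\succeq0$ for $t=1,\dots,T$ and, for $t=1,\dots,T-1$, $$m_{t+1}=Am_t+Bv_t,\qquad \Sigma_{t+1}=A\Sigma_tA^\top+BS_tA^\top+AS_t^\top B^\top+BY_tB^\top,\qquad \begin{bmatrix}Y_t&S_t\\S_t^\top&\Sigma_t\end{bmatrix}\succeq0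 .$$ **Corollary (optimal mass for the UDC problem).** The value $p^\star$ is finite and attained. Let $L=\log\det\Sigma_\alpha+\log\det\Sigma_\beta-2d$ and $$c^\ast=\sqrt{c_\alpha c_\beta}\,\exp\!\Bigl(-\frac{p^\star}{2\gamma}-\frac L4\Bigr).$$ The UDC problem has an optimal solution, and every optimal solution has mass $\pi_1(\mathbb R^d)=c^\ast$. Moreover, solving the SDP and then updating the mass gives a globally optimal UDC solution: for every minimizer $\{m_t,\Sigma_t,v_t,S_t,Y_t\}$ of the SDP, the matrices $K_t=S_t\Sigma_t^\dagger$, $W_t=Y_t-S_t\Sigma_t^\dagger S_t^\top$ (with $\dagger$ the Moore–Penrose inverse) satisfy $$S_t=K_t\Sigma_t,\qquad Y_t=K_t\Sigma_tK_t^\top+W_t,\qquad W_t\succeq0\qquad(1\le t\le T-1),$$ and for any $K_t,W_t$ satisfying these relations the pair $\pi_1=c^\ast\mathcal N(m_1,\Sigma_1)$, $U_t(\cdot\mid x)=\mathcal N\bigl(v_t+K_t(x-m_t),W_t\bigr)$ is admissible and minimizes $J$ over all admissible pairs. -/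

import Mathlib

open MeasureTheory ProbabilityTheory InformationTheory
open scoped ENNReal Matrix

namespace UDC

/-- The Euclidean space `ℝᵏ` with its Euclidean norm. -/
abbrev E (k : ℕ) : Type := EuclideanSpace ℝ (Fin k)

/-- Data of an unbalanced density control problem: state dimension `d`, control dimension `d'`,
and `N` control steps, so that the horizon is `T = N + 1`. Time `t = 1, …, T` is indexed by
`Fin (N + 1)` (index `0` is time `1`, index `Fin.last N` is time `T`) and the control times
`t = 1, …, T - 1` by `Fin N`. -/
structure Data (d d' N : ℕ) where
  /-- the system matrix -/
  A : Matrix (Fin d) (Fin d) ℝ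
  /-- the control matrix -/
  B : Matrix (Fin d) (Fin d') ℝ
  /-- the weight of the KL penalties -/
  γ : ℝ
  /-- masses of the two reference measures -/
  cα : ℝ
  cβ : ℝ
  /-- means of the two (normalized) reference measures -/
  mα : E d
  mβ : E d
  /-- covariances of the two (normalized) reference measures -/
  covα : Matrix (Fin d) (Fin d) ℝ
  covβ : Matrix (Fin d) (Fin d) ℝ

/-- Standing assumptions: `A` nonsingular, `γ, cα, cβ > 0`, and `Σα, Σβ` positive definite. -/
structure Data.Valid {d d' N : ℕ} (D : Data d d' N) : Prop where
  A_nonsing : D.A.det ≠ 0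
  γ_pos : 0 < D.γ
  cα_pos : 0 < D.cα
  cβ_pos : 0 < D.cβ
  covα_pos : D.covα.PosDef
  covβ_pos : D.covβ.PosDef

/-- The unbalanced Gaussian measure `c • 𝒩(m, S)`. -/
noncomputable def gaussianMeasure {k : ℕ} (c : ℝ) (m : E k) (S : Matrix (Fin k) (Fin k) ℝ) :
    Measure (E k) :=
  ENNReal.ofReal c • multivariateGaussian m S

/-- Membership in `ℳ₂⁺(ℝᵏ)`: finite measures with finite second moment. -/
def MemM2 {k : ℕ} (μ : Measure (E k)) : Prop :=
  IsFiniteMeasure μ ∧ ∫⁻ x, ‖x‖ₑ ^ 2 ∂μ < ∞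

section Problem

variable {d d' N : ℕ} (D : Data d d' N)

/-- The reference measure `α`. -/
noncomputable def Data.α : Measure (E d) := gaussianMeasure D.cα D.mα D.covα

/-- The reference measure `β`. -/
noncomputable def Data.β : Measure (E d) := gaussianMeasure D.cβ D.mβ D.covβ

/-- One step of the dynamics: `(x, u) ↦ A x + B u`. -/
noncomputable def Data.step (p : E d × E d') : E d :=
  Matrix.toEuclideanLin D.A p.1 + Matrix.toEuclideanLin D.B p.2

/-- The state measures: `π₁` is given and `π_{t+1}` is the image of `π_t(dx) U_t(du | x)` under
`(x, u) ↦ A x + B u`. -/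
noncomputable def Data.stateMeasure (π₁ : Measure (E d)) (U : Fin N → Kernel (E d) (E d')) :
    Fin (N + 1) → Measure (E d) :=
  Fin.induction π₁ fun t μ => (μ ⊗ₘ U t).map D.step

/-- The control energy `∑ₜ ∫∫ ‖u‖² U_t(du | x) π_t(dx)`. -/
noncomputable def Data.controlEnergy (π₁ : Measure (E d)) (U : Fin N → Kernel (E d) (E d')) :
    ℝ≥0∞ :=
  ∑ t : Fin N, ∫⁻ x, ∫⁻ u, ‖u‖ₑ ^ 2 ∂(U t x) ∂(D.stateMeasure π₁ U t.castSucc)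

/-- The admissible set: randomized feedback policies (Markov kernels), state measures of finite
mass and finite second moment, finite control energy. -/
structure Data.Admissible (π₁ : Measure (E d)) (U : Fin N → Kernel (E d) (E d')) : Prop where
  markov : ∀ t, IsMarkovKernel (U t)
  memM2 : ∀ t, MemM2 (D.stateMeasure π₁ U t)
  energy : D.controlEnergy π₁ U < ∞

/-- The objective
`E[∑ₜ ‖u_t‖²] + γ KL(π₁ ‖ α) + γ KL(π_T ‖ β)`, with values in `[0, ∞]`.
`klDiv μ ν` is `∫ log (dμ/dν) dμ - μ(ℝᵈ) + ν(ℝᵈ)` for `μ ≪ ν`, and `∞` otherwise. -/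
noncomputable def Data.J (π₁ : Measure (E d)) (U : Fin N → Kernel (E d) (E d')) : ℝ≥0∞ :=
  D.controlEnergy π₁ U + ENNReal.ofReal D.γ * klDiv π₁ D.α
    + ENNReal.ofReal D.γ * klDiv (D.stateMeasure π₁ U (Fin.last N)) D.β

/-- `(π₁, U)` is a globally optimal solution of the UDC problem. -/
def Data.IsOptimal (π₁ : Measure (E d)) (U : Fin N → Kernel (E d) (E d')) : Prop :=
  D.Admissible π₁ U ∧
    ∀ (π₁' : Measure (E d)) (U' : Fin N → Kernel (E d) (E d')),
      D.Admissible π₁' U' → D.J π₁ U ≤ D.J π₁' U'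

end Problem

/-- The decision variables `({m_t, Σ_t}, {v_t, S_t, Y_t})` of the lifted SDP; `Σ_t` is `cov t`. -/
structure SDPVar (d d' N : ℕ) where
  m : Fin (N + 1) → E d
  cov : Fin (N + 1) → Matrix (Fin d) (Fin d) ℝ
  v : Fin N → E d'
  S : Fin N → Matrix (Fin d') (Fin d) ℝ
  Y : Fin N → Matrix (Fin d') (Fin d') ℝ

section SDP

variable {d d' N : ℕ} (D : Data d d' N)

/-- Feasibility for the lifted SDP. The condition `cov` says that the `Σ_t` are covariance matrices;
it follows from the other constraints unless there is no control step (`N = 0`). -/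
structure Data.SDPFeasible (z : SDPVar d d' N) : Prop where
  mean : ∀ t : Fin N, z.m t.succ
    = Matrix.toEuclideanLin D.A (z.m t.castSucc) + Matrix.toEuclideanLin D.B (z.v t)
  covDyn : ∀ t : Fin N, z.cov t.succ
    = D.A * z.cov t.castSucc * D.Aᵀ + D.B * z.S t * D.Aᵀ + D.A * (z.S t)ᵀ * D.Bᵀ
      + D.B * z.Y t * D.Bᵀ
  lmi : ∀ t : Fin N,
    (Matrix.fromBlocks (z.Y t) (z.S t) (z.S t)ᵀ (z.cov t.castSucc)).PosSemidef
  cov : ∀ t, (z.cov t).PosSemidef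

/-- The mean term `M(m₁, m_T)`. -/
noncomputable def Data.M (m₁ mT : E d) : ℝ :=
  1 / 2 * ((m₁ - D.mα).ofLp ⬝ᵥ (D.covα⁻¹ *ᵥ (m₁ - D.mα).ofLp))
    + 1 / 2 * ((mT - D.mβ).ofLp ⬝ᵥ (D.covβ⁻¹ *ᵥ (mT - D.mβ).ofLp))

/-- The covariance term `S(Σ₁, Σ_T)` for positive definite `Σ₁, Σ_T`. -/
noncomputable def Data.covTerm (C₁ CT : Matrix (Fin d) (Fin d) ℝ) : ℝ :=
  1 / 2 * ((D.covα⁻¹ * C₁).trace + (D.covβ⁻¹ * CT).trace - Real.log C₁.det - Real.log CT.det)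

open scoped Classical in
/-- The objective of the lifted SDP,
`∑ₜ (‖v_t‖² + tr Y_t) + γ M(m₁, m_T) + γ S(Σ₁, Σ_T)`, where `-log det = +∞` on singular
covariance matrices. -/
noncomputable def Data.sdpObjective (z : SDPVar d d' N) : EReal :=
  if (z.cov 0).PosDef ∧ (z.cov (Fin.last N)).PosDef then
    (((∑ t : Fin N, (‖z.v t‖ ^ 2 + (z.Y t).trace))
      + D.γ * D.M (z.m 0) (z.m (Fin.last N))
      + D.γ * D.covTerm (z.cov 0) (z.cov (Fin.last N)) : ℝ) : EReal)
  else ⊤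

/-- The optimal value of the lifted SDP (an infimum in the extended reals). -/
noncomputable def Data.sdpValue : EReal :=
  ⨅ (z : SDPVar d d' N) (_ : D.SDPFeasible z), D.sdpObjective z

/-- `z` solves the lifted SDP: it is feasible and attains the optimal value. -/
def Data.IsSDPSolution (z : SDPVar d d' N) : Prop :=
  D.SDPFeasible z ∧ D.sdpObjective z = D.sdpValue

/-- `L = log det Σα + log det Σβ - 2 d`. -/
noncomputable def Data.L : ℝ := Real.log D.covα.det + Real.log D.covβ.det - 2 * (d : ℝ)

/-- The mass update `c⋆ = √(cα cβ) · exp(-p / (2γ) - L / 4)`. -/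
noncomputable def Data.massUpdate (p : ℝ) : ℝ :=
  Real.sqrt (D.cα * D.cβ) * Real.exp (-p / (2 * D.γ) - D.L / 4)

end SDP

/-- The Moore-Penrose inverse of a real symmetric matrix: nonzero eigenvalues are inverted, the
kernel is kept. The four Penrose conditions are `pinv_spec` below. -/
noncomputable def pinv {k : ℕ} (X : Matrix (Fin k) (Fin k) ℝ) : Matrix (Fin k) (Fin k) ℝ :=
  cfc (fun x : ℝ => x⁻¹) X

theorem pinv_spec {k : ℕ} {X : Matrix (Fin k) (Fin k) ℝ} (hX : X.IsHermitian) :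
    X * pinv X * X = X ∧ pinv X * X * pinv X = pinv X ∧
      (X * pinv X)ᵀ = X * pinv X ∧ (pinv X * X)ᵀ = pinv X * X := by
  have hs : IsSelfAdjoint X := hX
  have hc : ∀ f : ℝ → ℝ, ContinuousOn f (spectrum ℝ X) := fun f => by
    have : Finite (spectrum ℝ X) := Matrix.finite_real_spectrum
    rw [continuousOn_iff_continuous_domRestrict]
    fun_prop
  have h1 : X * pinv X = cfc (fun x : ℝ => x * x⁻¹) X := by
    rw [cfc_mul _ _ X (hc _) (hc _), cfc_id' ℝ X]; rfl
  have h2 : pinv X * X = cfc (fun x : ℝ => x⁻¹ * x) X := by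
    rw [cfc_mul _ _ X (hc _) (hc _), cfc_id' ℝ X]; rfl
  refine ⟨?_, ?_, ?_, ?_⟩
  · have : X * pinv X * X = cfc (fun x : ℝ => x * x⁻¹ * x) X := by
      rw [cfc_mul _ _ X (hc _) (hc _), cfc_id' ℝ X, h1]
    rw [this]
    simp only [mul_inv_mul_cancel]
    exact cfc_id' ℝ X
  · have : pinv X * X * pinv X = cfc (fun x : ℝ => x⁻¹ * x * x⁻¹) X := by
      rw [cfc_mul _ _ X (hc _) (hc _), h2]; rfl
    rw [this]
    have e : (fun x : ℝ => x⁻¹ * x * x⁻¹) = fun x => x⁻¹ := by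
      funext x
      by_cases hx : x = 0 <;> simp [hx]
    rw [e]
    rfl
  · rw [h1]
    have : IsSelfAdjoint (cfc (fun x : ℝ => x * x⁻¹) X) := cfc_predicate _ X
    simpa [IsSelfAdjoint, Matrix.star_eq_conjTranspose] using this
  · rw [h2]
    have : IsSelfAdjoint (cfc (fun x : ℝ => x⁻¹ * x) X) := cfc_predicate _ X
    simpa [IsSelfAdjoint, Matrix.star_eq_conjTranspose] using this

/-- The affine-Gaussian feedback law `U(· | x) = 𝒩(v + K (x - m), W)`, i.e.
`u = K (x - m) + v + w` with `w ∼ 𝒩(0, W)`. -/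
noncomputable def affineGaussianPolicy {d d' : ℕ} (m : E d) (v : E d')
    (K : Matrix (Fin d') (Fin d) ℝ) (W : Matrix (Fin d') (Fin d') ℝ) : Kernel (E d) (E d') where
  toFun x := multivariateGaussian (v + Matrix.toEuclideanLin K (x - m)) W
  measurable' := by
    have h : (fun x : E d => multivariateGaussian (v + Matrix.toEuclideanLin K (x - m)) W)
        = fun x => (((Kernel.id : Kernel (E d) (E d)) ×ₖ
            Kernel.const (E d) (multivariateGaussian (0 : E d') W)).map
          (fun q : E d × E d' => v + Matrix.toEuclideanLin K (q.1 - m) + q.2)) x := by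
      funext x
      have hl : Measurable (fun y : E d => Matrix.toEuclideanLin K y) :=
        (LinearMap.continuous_of_finiteDimensional (Matrix.toEuclideanLin K)).measurable
      have hm : Measurable
          (fun q : E d × E d' => v + Matrix.toEuclideanLin K (q.1 - m) + q.2) :=
        ((hl.comp (measurable_fst.sub_const m)).const_add v).add measurable_snd
      rw [Kernel.map_apply _ hm, Kernel.prod_apply, Kernel.id_apply, Kernel.const_apply,
        Measure.dirac_prod, Measure.map_map hm (by fun_prop), multivariateGaussian,
        multivariateGaussian, Measure.map_map (by fun_prop) (by fun_prop)]
      congr 1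
      funext y
      simp
    rw [h]
    exact Kernel.measurable _

/-- `(K, W)` are feedback gains and control covariances recovered from `z` through the change of
variables `S_t = K_t Σ_t`, `Y_t = K_t Σ_t K_tᵀ + W_t`. -/
structure SDPVar.Recovers {d d' N : ℕ} (z : SDPVar d d' N)
    (K : Fin N → Matrix (Fin d') (Fin d) ℝ) (W : Fin N → Matrix (Fin d') (Fin d') ℝ) : Prop where
  gain : ∀ t, z.S t = K t * z.cov t.castSucc
  noise : ∀ t, z.Y t = K t * z.cov t.castSucc * (K t)ᵀ + W t
  psd : ∀ t, (W t).PosSemidef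

end UDC

/-! The control problem separates into a shape problem and a one-dimensional mass problem. Write a
nonzero initial measure as `π₁ = c • P` with `P` a probability measure. The dynamics and the energy
are linear in the initial measure, so at fixed `P` and policy the mass enters only through linear
terms and the `c log c` terms of the two divergences.

At fixed mass the shape problem is the SDP. The moments of any admissible pair are SDP-feasible, and
the energy is exactly their energy term. The density ratio of two Gaussians has a quadratic
logarithm, whose integral depends only on mean and covariance; with Gibbs' inequality this shows
that replacing an end law by the Gaussian with the same moments does not increase the divergence
(`gaussianKL_le_toReal_klDiv`). Conversely, `K` and `W` recovered from a feasible point give an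
affine-Gaussian policy whose states are Gaussian with exactly the prescribed moments
(`SDPVar.Recovers.stateMeasure_eq`), and every inequality becomes an equality. Finite divergence
forces absolute continuity, hence nonsingular end covariances; this matches the convention `-log det
= ∞`.

So the best cost at mass `c` is `massCost p c = γ (cα + cβ) + 2γ (c log (c / c⋆) - c)`, with `c⋆ =
massUpdate p` its unique minimizer over `c > 0`. The zero measure costs at least `γ (cα + cβ)`,
strictly more than the minimum. Attainment in the SDP is a compactness argument: half of the trace
penalty controls `log det`, and the rest bounds the initial covariance. -/

namespace UDC

/-! ### Real positive semidefinite matrices -/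

section Matrices

open Matrix

variable {ι κ : Type*} [Fintype ι] [Fintype κ]

theorem posSemidef_of_real {M : Matrix ι ι ℝ} (h : Mᵀ = M) (h' : ∀ x, 0 ≤ x ⬝ᵥ (M *ᵥ x)) :
    M.PosSemidef :=
  PosSemidef.of_dotProduct_mulVec_nonneg (by rwa [IsHermitian, conjTranspose_eq_transpose_of_trivial])
    (by simpa using h')

theorem _root_.Matrix.PosSemidef.transpose_eq {ι : Type*} {M : Matrix ι ι ℝ} (h : M.PosSemidef) : Mᵀ = M := by
  have := h.isHermitian
  rwa [IsHermitian, conjTranspose_eq_transpose_of_trivial] at this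

theorem _root_.Matrix.PosSemidef.quad_nonneg {M : Matrix ι ι ℝ} (h : M.PosSemidef) (x : ι → ℝ) :
    0 ≤ x ⬝ᵥ (M *ᵥ x) := by
  simpa using h.dotProduct_mulVec_nonneg x

theorem _root_.Matrix.PosSemidef.congr_right {M : Matrix ι ι ℝ} (h : M.PosSemidef)
    (B : Matrix κ ι ℝ) : (B * M * Bᵀ).PosSemidef := by
  simpa using h.mul_mul_conjTranspose_same B

theorem isClosed_posSemidef : IsClosed {M : Matrix ι ι ℝ | M.PosSemidef} := by
  have : {M : Matrix ι ι ℝ | M.PosSemidef}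
      = {M | Mᵀ = M} ∩ ⋂ x : ι → ℝ, {M | 0 ≤ x ⬝ᵥ (M *ᵥ x)} := by
    ext M
    simp only [Set.mem_ofPred_eq, Set.mem_inter_iff, Set.mem_iInter]
    exact ⟨fun h => ⟨h.transpose_eq, h.quad_nonneg⟩, fun h => posSemidef_of_real h.1 h.2⟩
  rw [this]
  refine (isClosed_eq (by fun_prop) (by fun_prop)).inter (isClosed_iInter fun x => ?_)
  exact isClosed_le (by fun_prop) (by fun_prop)

theorem trace_mul_vecMulVec (C : Matrix ι ι ℝ) (x : ι → ℝ) :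
    (C * vecMulVec x x).trace = x ⬝ᵥ (C *ᵥ x) := by
  rw [mul_vecMulVec, trace_vecMulVec, dotProduct_comm]

variable [DecidableEq ι]

/-- Testing the quadratic form on `eᵢ ± eⱼ` gives `2 |M i j| ≤ M i i + M j j`. A trace bound thus
confines a positive semidefinite matrix to a compact set. -/
theorem _root_.Matrix.PosSemidef.abs_entry_le_trace {M : Matrix ι ι ℝ} (h : M.PosSemidef)
    (i j : ι) : |M i j| ≤ M.trace := by
  have hd : ∀ k, M k k ≤ M.trace := fun k =>
    Finset.single_le_sum (f := fun k => M k k) (fun k _ => h.diag_nonneg) (Finset.mem_univ k)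
  have hs : M j i = M i j := congrFun (congrFun h.transpose_eq i) j
  have h1 := h.quad_nonneg (Pi.single i 1 + Pi.single j 1)
  have h2 := h.quad_nonneg (Pi.single i 1 - Pi.single j 1)
  simp only [mulVec_add, mulVec_sub, add_dotProduct, sub_dotProduct, dotProduct_add,
    dotProduct_sub, mulVec_single_one, single_one_dotProduct, col_apply] at h1 h2
  have := hd i
  have := hd j
  rw [abs_le]
  constructor <;> linarith

/-- A positive definite real matrix has a symmetric invertible square root. -/
theorem exists_sqrt {C : Matrix ι ι ℝ} (h : C.PosDef) :
    ∃ R : Matrix ι ι ℝ, Rᵀ = R ∧ R.det ≠ 0 ∧ R * R = C := by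
  open scoped MatrixOrder in
  have hR : CFC.sqrt C * CFC.sqrt C = C := CFC.sqrt_mul_sqrt_self C h.posSemidef.nonneg
  have hs : (CFC.sqrt C).PosSemidef := (CFC.sqrt_nonneg C).posSemidef
  refine ⟨CFC.sqrt C, hs.transpose_eq, fun h0 => ?_, hR⟩
  have := h.det_pos
  rw [← hR, det_mul, h0] at this
  simp at this

/-- Apply `log (λ / 2) ≤ λ / 2 - 1` to each eigenvalue. The scaling by `1/2` leaves half of the
trace unspent, which gives coercivity of `tr X - log det X`. -/
theorem log_det_le {X : Matrix ι ι ℝ} (h : X.PosDef) :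
    Real.log X.det ≤ X.trace / 2 + Fintype.card ι * (Real.log 2 - 1) := by
  have e1 := h.isHermitian.det_eq_prod_eigenvalues
  have e2 := h.isHermitian.trace_eq_sum_eigenvalues
  simp only [RCLike.ofReal_real_eq_id, id_eq] at e1 e2
  rw [e1, e2, Real.log_prod (fun i _ => (h.eigenvalues_pos i).ne'), Finset.sum_div]
  have : (Fintype.card ι : ℝ) * (Real.log 2 - 1) = ∑ i : ι, (Real.log 2 - 1) := by
    rw [Finset.sum_const, Finset.card_univ, nsmul_eq_mul]
  rw [this, ← Finset.sum_add_distrib]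
  refine Finset.sum_le_sum fun i _ => ?_
  have h0 := h.eigenvalues_pos i
  have := Real.log_le_sub_one_of_pos (half_pos h0)
  rw [Real.log_div h0.ne' (by norm_num)] at this
  linarith

/-- Conjugation by `R = C^{1/2}` reduces to `C = 1`: `R X R` has trace `tr (C X)` and determinant
`det C * det X`. -/
theorem log_det_le_trace_mul {C X : Matrix ι ι ℝ} (hC : C.PosDef) (hX : X.PosDef) :
    Real.log X.det ≤ (C * X).trace / 2 + Fintype.card ι * (Real.log 2 - 1) - Real.log C.det := by
  obtain ⟨R, hRt, hRd, hR⟩ := exists_sqrt hC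
  have hZ : (R * X * R).PosSemidef := by simpa [hRt] using hX.posSemidef.congr_right R
  have hdet : (R * X * R).det = C.det * X.det := by rw [← hR]; simp [det_mul]; ring
  have hZ' : (R * X * R).PosDef := by
    rw [hZ.posDef_iff_det_ne_zero, hdet]
    exact (mul_pos hC.det_pos hX.det_pos).ne'
  have := log_det_le hZ'
  rw [hdet, Real.log_mul hC.det_pos.ne' hX.det_pos.ne', trace_mul_cycle, hR] at this
  linarith

theorem trace_mul_nonneg {C X : Matrix ι ι ℝ} (hC : C.PosDef) (hX : X.PosSemidef) :
    0 ≤ (C * X).trace := by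
  obtain ⟨R, hRt, -, hR⟩ := exists_sqrt hC
  have hZ : (R * X * R).PosSemidef := by simpa [hRt] using hX.congr_right R
  have := hZ.trace_nonneg
  rwa [trace_mul_cycle, hR] at this

/-- With `R = C^{1/2}` one has `tr X = tr (C⁻¹ (R X R))`, and the entries of `R X R` are at most its
trace `tr (C X)`. Hence `k` is the sum of the absolute entries of `C⁻¹`. -/
theorem exists_trace_le {C : Matrix ι ι ℝ} (hC : C.PosDef) :
    ∃ k : ℝ, 0 ≤ k ∧ ∀ X : Matrix ι ι ℝ, X.PosSemidef → X.trace ≤ k * (C * X).trace := by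
  obtain ⟨R, hRt, hRd, hR⟩ := exists_sqrt hC
  refine ⟨∑ i, ∑ j, |(R⁻¹ * R⁻¹) i j|, by positivity, fun X hX => ?_⟩
  have hu : IsUnit R.det := isUnit_iff_ne_zero.2 hRd
  have hZ : (R * X * R).PosSemidef := by simpa [hRt] using hX.congr_right R
  have e : X.trace = (R⁻¹ * R⁻¹ * (R * X * R)).trace := by
    have : R⁻¹ * R⁻¹ * (R * X * R) = R⁻¹ * (X * R) := by
      simp [mul_assoc, nonsing_inv_mul_cancel_left _ _ hu]
    rw [this, trace_mul_comm, mul_assoc, mul_nonsing_inv _ hu, mul_one]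
  have e' : (R * X * R).trace = (C * X).trace := by rw [trace_mul_cycle, hR]
  rw [e, ← e', trace, Finset.sum_mul]
  refine Finset.sum_le_sum fun i _ => ?_
  rw [diag_apply, mul_apply, Finset.sum_mul]
  refine Finset.sum_le_sum fun j _ => (le_abs_self _).trans ?_
  rw [abs_mul]
  exact mul_le_mul_of_nonneg_left (hZ.abs_entry_le_trace j i) (abs_nonneg _)

/-- The trace comparison applied to the rank-one matrix `x xᵀ`. -/
theorem exists_norm_sq_le {k : ℕ} {C : Matrix (Fin k) (Fin k) ℝ} (hC : C.PosDef) :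
    ∃ b : ℝ, 0 ≤ b ∧ ∀ x : E k, ‖x‖ ^ 2 ≤ b * (x.ofLp ⬝ᵥ (C *ᵥ x.ofLp)) := by
  obtain ⟨b, hb, h⟩ := exists_trace_le hC
  refine ⟨b, hb, fun x => ?_⟩
  have := h (vecMulVec x.ofLp x.ofLp) (by simpa using posSemidef_vecMulVec_self_star x.ofLp)
  rw [trace_mul_vecMulVec, trace_vecMulVec] at this
  rw [EuclideanSpace.real_norm_sq_eq]
  simpa [dotProduct, sq] using this

/-! ### Recovery of the gain and the control covariance from the linear matrix inequality -/

theorem pinv_transpose {k : ℕ} {X : Matrix (Fin k) (Fin k) ℝ} : (pinv X)ᵀ = pinv X := by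
  have : IsSelfAdjoint (pinv X) := cfc_predicate _ X
  simpa [IsSelfAdjoint, Matrix.star_eq_conjTranspose] using this

/-- The matrix inequality forces `S` to vanish on `ker C`, and `C† C - 1` maps into `ker C`. -/
theorem mul_pinv_mul_of_block {d d' : ℕ} {Y : Matrix (Fin d') (Fin d') ℝ}
    {S : Matrix (Fin d') (Fin d) ℝ} {C : Matrix (Fin d) (Fin d) ℝ}
    (h : (fromBlocks Y S Sᵀ C).PosSemidef) (hC : C.PosSemidef) : S * pinv C * C = S := by
  have hp := pinv_spec hC.isHermitian
  have key : ∀ (y : Fin d' → ℝ) (x : Fin d → ℝ), C *ᵥ x = 0 → y ⬝ᵥ (S *ᵥ x) = 0 := by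
    intro y x hx
    -- For `x ∈ ker C` the block form at `(y, t x)` is affine in `t`. Being nonnegative for all `t`,
    -- it has zero slope.
    have hq : ∀ t : ℝ, 0 ≤ y ⬝ᵥ (Y *ᵥ y) + 2 * t * (y ⬝ᵥ (S *ᵥ x)) := by
      intro t
      have := h.quad_nonneg (Sum.elim y (t • x))
      have e : x ⬝ᵥ Sᵀ *ᵥ y = y ⬝ᵥ S *ᵥ x := by
        rw [mulVec_transpose, dotProduct_comm, dotProduct_mulVec]
      simp only [fromBlocks_mulVec, Sum.elim_comp_inl, Sum.elim_comp_inr, sumElim_dotProduct_sumElim,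
        mulVec_smul, hx, smul_zero, add_zero, dotProduct_add, dotProduct_smul, smul_dotProduct,
        smul_eq_mul, e] at this
      linarith
    by_contra h0
    -- At this `t` the affine function would take the value `-1`.
    have := hq (-(y ⬝ᵥ (Y *ᵥ y) + 1) / (2 * (y ⬝ᵥ (S *ᵥ x))))
    have e : 2 * (-(y ⬝ᵥ (Y *ᵥ y) + 1) / (2 * (y ⬝ᵥ (S *ᵥ x)))) * (y ⬝ᵥ (S *ᵥ x))
        = -(y ⬝ᵥ (Y *ᵥ y) + 1) := by field_simp
    rw [e] at this
    linarith
  have h0 : S * (pinv C * C - 1) = 0 := by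
    ext i j
    have := key (Pi.single i 1) ((pinv C * C - 1) *ᵥ Pi.single j 1) (by
      rw [mulVec_mulVec, mul_sub, ← mul_assoc, hp.1, mul_one, sub_self, zero_mulVec])
    rw [mulVec_mulVec, mulVec_single_one, single_one_dotProduct] at this
    simpa using this
  rwa [Matrix.mul_sub, Matrix.mul_one, sub_eq_zero, ← Matrix.mul_assoc] at h0

/-- Congruence of the block matrix by `[1, -S C†]` yields the generalized Schur complement, since `S
C† C = S` cancels the remaining terms. -/
theorem schur_pinv_posSemidef {d d' : ℕ} {Y : Matrix (Fin d') (Fin d') ℝ}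
    {S : Matrix (Fin d') (Fin d) ℝ} {C : Matrix (Fin d) (Fin d) ℝ}
    (h : (fromBlocks Y S Sᵀ C).PosSemidef) (hC : C.PosSemidef) :
    (Y - S * pinv C * Sᵀ).PosSemidef := by
  have hp := pinv_spec hC.isHermitian
  have := h.congr_right (fromCols 1 (-(S * pinv C)))
  rw [fromCols_mul_fromBlocks, transpose_fromCols, fromCols_mul_fromRows] at this
  convert this using 1
  have e : S * pinv C * C = S := mul_pinv_mul_of_block h hC
  simp [e, pinv_transpose, sub_eq_add_neg]

theorem SDPVar.recovers_pinv {d d' N : ℕ} {D : Data d d' N} {z : SDPVar d d' N}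
    (hz : D.SDPFeasible z) : z.Recovers (fun t => z.S t * pinv (z.cov t.castSucc))
      (fun t => z.Y t - z.S t * pinv (z.cov t.castSucc) * (z.S t)ᵀ) where
  gain t := (mul_pinv_mul_of_block (hz.lmi t) (hz.cov _)).symm
  noise t := by
    rw [mul_pinv_mul_of_block (hz.lmi t) (hz.cov _), transpose_mul, pinv_transpose, ← Matrix.mul_assoc]
    abel
  psd t := schur_pinv_posSemidef (hz.lmi t) (hz.cov _)

end Matrices

/-! ### The lifted SDP has a solution -/

section CompactRange

variable {Z X X' W : Type*} [TopologicalSpace X] [TopologicalSpace X'] [TopologicalSpace W]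

/-- On `s`, the map `f` takes its values in a compact set. -/
def CompactRangeOn (s : Set Z) (f : Z → X) : Prop :=
  ∃ K : Set X, IsCompact K ∧ ∀ z ∈ s, f z ∈ K

theorem CompactRangeOn.comp {s : Set Z} {f : Z → X} (hf : CompactRangeOn s f) {h : X → W}
    (hh : Continuous h) : CompactRangeOn s (fun z => h (f z)) := by
  obtain ⟨K, hK, hs⟩ := hf
  exact ⟨h '' K, hK.image hh, fun z hz => ⟨f z, hs z hz, rfl⟩⟩

theorem CompactRangeOn.prodMk {s : Set Z} {f : Z → X} {g : Z → X'} (hf : CompactRangeOn s f)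
    (hg : CompactRangeOn s g) : CompactRangeOn s (fun z => (f z, g z)) := by
  obtain ⟨K, hK, hs⟩ := hf
  obtain ⟨K', hK', hs'⟩ := hg
  exact ⟨K ×ˢ K', hK.prod hK', fun z hz => ⟨hs z hz, hs' z hz⟩⟩

theorem CompactRangeOn.pi {ι : Type*} {s : Set Z} {f : Z → ι → X}
    (hf : ∀ i, CompactRangeOn s (fun z => f z i)) : CompactRangeOn s f := by
  choose K hK hs using hf
  exact ⟨Set.univ.pi K, isCompact_univ_pi hK, fun z hz i _ => hs i z hz⟩

theorem CompactRangeOn.congr {s : Set Z} {f g : Z → X} (hf : CompactRangeOn s f)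
    (h : ∀ z ∈ s, g z = f z) : CompactRangeOn s g := by
  obtain ⟨K, hK, hs⟩ := hf
  exact ⟨K, hK, fun z hz => h z hz ▸ hs z hz⟩

theorem compactRangeOn_of_abs_entry_le {m n : Type*} {s : Set Z} {f : Z → Matrix m n ℝ} (R : ℝ)
    (h : ∀ z ∈ s, ∀ i j, |f z i j| ≤ R) : CompactRangeOn s f :=
  ⟨Set.univ.pi fun _ => Set.univ.pi fun _ => Set.Icc (-R) R,
    isCompact_univ_pi fun _ => isCompact_univ_pi fun _ => isCompact_Icc,
    fun z hz i _ j _ => abs_le.1 (h z hz i j)⟩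

theorem compactRangeOn_of_norm_sq_le {k : ℕ} {s : Set Z} {f : Z → E k} (R : ℝ)
    (h : ∀ z ∈ s, ‖f z‖ ^ 2 ≤ R) : CompactRangeOn s f :=
  ⟨Metric.closedBall 0 (Real.sqrt R), isCompact_closedBall _ _, fun z hz => by
    rw [mem_closedBall_zero_iff]
    exact Real.le_sqrt_of_sq_le (h z hz)⟩

end CompactRange

/-! ### Coercivity, compactness and attainment for the SDP. -/

section Existence

open Matrix

variable {d d' N : ℕ}

/-- The SDP objective without the convention for singular covariances. -/
noncomputable def Data.sdpReal (D : Data d d' N) (z : SDPVar d d' N) : ℝ :=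
  (∑ t : Fin N, (‖z.v t‖ ^ 2 + (z.Y t).trace)) + D.γ * D.M (z.m 0) (z.m (Fin.last N))
      + D.γ * D.covTerm (z.cov 0) (z.cov (Fin.last N))

/-- The SDP variables as a product type. -/
abbrev SDPTuple (d d' N : ℕ) : Type :=
  ((Fin (N + 1) → E d) × (Fin (N + 1) → Matrix (Fin d) (Fin d) ℝ)) ×
    (Fin N → E d') × (Fin N → Matrix (Fin d') (Fin d) ℝ) × (Fin N → Matrix (Fin d') (Fin d') ℝ)

/-- The SDP variables with given components. -/
def SDPVar.ofTuple (x : SDPTuple d d' N) : SDPVar d d' N :=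
  ⟨x.1.1, x.1.2, x.2.1, x.2.2.1, x.2.2.2⟩

/-- Feasible points with nonsingular end covariances and objective at most `c`. -/
def Data.sublevel (D : Data d d' N) (c : ℝ) : Set (SDPTuple d d' N) :=
  {x | D.SDPFeasible (.ofTuple x) ∧ (x.1.2 0).PosDef ∧ (x.1.2 (Fin.last N)).PosDef ∧
    D.sdpReal (.ofTuple x) ≤ c}

theorem SDPVar.trace_Y_nonneg {D : Data d d' N} {z : SDPVar d d' N} (hz : D.SDPFeasible z)
    (t : Fin N) : 0 ≤ (z.Y t).trace := by
  have hY : (z.Y t).PosSemidef := (hz.lmi t).submatrix Sum.inl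
  exact hY.trace_nonneg

/-- The individual terms of the objective are bounded on sublevel sets. -/
theorem Data.exists_bound_sublevel (D : Data d d' N) (hD : D.Valid) (c : ℝ) :
    ∃ R : ℝ, ∀ x ∈ D.sublevel c,
      (∀ t, ‖x.2.1 t‖ ^ 2 ≤ R) ∧ (∀ t, (x.2.2.2 t).trace ≤ R) ∧ ‖x.1.1 0‖ ^ 2 ≤ R ∧
      (x.1.2 0).trace ≤ R ∧ Real.exp (-R) ≤ (x.1.2 0).det ∧
      Real.exp (-R) ≤ (x.1.2 (Fin.last N)).det := by
  have hα := hD.covα_pos.inv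
  have hβ := hD.covβ_pos.inv
  have hγ := hD.γ_pos
  obtain ⟨k, hk, hk'⟩ := exists_trace_le hα
  obtain ⟨b, hb, hb'⟩ := exists_norm_sq_le hα
  set κ₁ : ℝ := (d : ℝ) * (Real.log 2 - 1) - Real.log D.covα⁻¹.det with hκ₁
  set κ₂ : ℝ := (d : ℝ) * (Real.log 2 - 1) - Real.log D.covβ⁻¹.det with hκ₂
  set c' : ℝ := |c| + D.γ * (|κ₁| + |κ₂|) with hc'
  have hc'0 : 0 ≤ c' := by positivity
  -- The constant is a sum of nonnegative bounds, so that one `R` serves all six estimates.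
  refine ⟨c' + 2 * (b * (2 * c' / D.γ)) + 2 * ‖D.mα‖ ^ 2 + k * (4 * c' / D.γ) + 4 * c' / D.γ
    + |κ₁| + |κ₂|, fun x hx => ?_⟩
  obtain ⟨hF, h0, hT, hle⟩ := hx
  have hv : ∀ t ∈ Finset.univ, 0 ≤ ‖x.2.1 t‖ ^ 2 + (x.2.2.2 t).trace := fun t _ =>
    add_nonneg (sq_nonneg _) (SDPVar.trace_Y_nonneg hF t)
  have hsum := Finset.sum_nonneg hv
  have q1 := hα.posSemidef.quad_nonneg (x.1.1 0 - D.mα).ofLp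
  have q2 := hβ.posSemidef.quad_nonneg (x.1.1 (Fin.last N) - D.mβ).ofLp
  have t1 := trace_mul_nonneg hα h0.posSemidef
  have t2 := trace_mul_nonneg hβ hT.posSemidef
  have l1 := log_det_le_trace_mul hα h0
  have l2 := log_det_le_trace_mul hβ hT
  rw [Fintype.card_fin, add_sub_assoc, ← hκ₁] at l1
  rw [Fintype.card_fin, add_sub_assoc, ← hκ₂] at l2
  have a1 := le_abs_self κ₁
  have a2 := le_abs_self κ₂
  have ac := le_abs_self c
  unfold Data.sdpReal Data.M Data.covTerm SDPVar.ofTuple at hle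
  simp only at hle
  set s := ∑ t : Fin N, (‖x.2.1 t‖ ^ 2 + (x.2.2.2 t).trace)
  set Q1 := (x.1.1 0 - D.mα).ofLp ⬝ᵥ D.covα⁻¹ *ᵥ (x.1.1 0 - D.mα).ofLp with hQ1
  set Q2 := (x.1.1 (Fin.last N) - D.mβ).ofLp ⬝ᵥ D.covβ⁻¹ *ᵥ (x.1.1 (Fin.last N) - D.mβ).ofLp
  set T1 := (D.covα⁻¹ * x.1.2 0).trace with hT1
  set T2 := (D.covβ⁻¹ * x.1.2 (Fin.last N)).trace
  set L1 := Real.log (x.1.2 0).det with hL1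
  set L2 := Real.log (x.1.2 (Fin.last N)).det with hL2
  -- Each `T / 2` is split into two quarters. One is paired with `-L / 2` and is nonnegative after
  -- adding `|κ| / 2`, by `log_det_le_trace_mul`; the other survives. All summands are then
  -- nonnegative, so each is bounded by the total.
  have key : s + D.γ * (Q1 / 2 + Q2 / 2 + (T1 / 2 - L1 + |κ₁|) / 2 + (T2 / 2 - L2 + |κ₂|) / 2
      + T1 / 4 + T2 / 4) ≤ c' := by
    rw [hc']
    have : 0 ≤ D.γ * (|κ₁| + |κ₂|) := by positivity
    linarith
  have hnn : 0 ≤ Q1 / 2 + Q2 / 2 + (T1 / 2 - L1 + |κ₁|) / 2 + (T2 / 2 - L2 + |κ₂|) / 2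
      + T1 / 4 + T2 / 4 := by linarith
  have hs : s ≤ c' := by
    have := mul_nonneg hγ.le hnn
    linarith
  have hin : Q1 / 2 + Q2 / 2 + (T1 / 2 - L1 + |κ₁|) / 2 + (T2 / 2 - L2 + |κ₂|) / 2
      + T1 / 4 + T2 / 4 ≤ c' / D.γ := by
    rw [le_div_iff₀ hγ, mul_comm]
    linarith
  have e2 : 2 * c' / D.γ = 2 * (c' / D.γ) := by ring
  have e4 : 4 * c' / D.γ = 4 * (c' / D.γ) := by ring
  rw [e2, e4]
  set C := c' / D.γ
  have hC : 0 ≤ C := by positivity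
  have hbC : 0 ≤ b * (2 * C) := by positivity
  have hkC : 0 ≤ k * (4 * C) := by positivity
  have hm := sq_nonneg ‖D.mα‖
  have k1 := abs_nonneg κ₁
  have k2 := abs_nonneg κ₂
  have hterm : ∀ t, ‖x.2.1 t‖ ^ 2 + (x.2.2.2 t).trace ≤ c' := fun t =>
    (Finset.single_le_sum hv (Finset.mem_univ t)).trans hs
  refine ⟨fun t => ?_, fun t => ?_, ?_, ?_, ?_, ?_⟩
  · have := hterm t
    have := SDPVar.trace_Y_nonneg hF t
    have : 0 ≤ (x.2.2.2 t).trace := this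
    linarith
  · have := hterm t
    have := sq_nonneg ‖x.2.1 t‖
    linarith
  · have h1 : ‖x.1.1 0 - D.mα‖ ^ 2 ≤ b * (2 * C) :=
      (hb' _).trans (mul_le_mul_of_nonneg_left (by linarith) hb)
    have h2 : ‖x.1.1 0‖ ≤ ‖x.1.1 0 - D.mα‖ + ‖D.mα‖ := by
      simpa using norm_add_le (x.1.1 0 - D.mα) D.mα
    have h3 : ‖x.1.1 0‖ ^ 2 ≤ 2 * ‖x.1.1 0 - D.mα‖ ^ 2 + 2 * ‖D.mα‖ ^ 2 := by
      have := pow_le_pow_left₀ (norm_nonneg _) h2 2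
      nlinarith [sq_nonneg (‖x.1.1 0 - D.mα‖ - ‖D.mα‖)]
    linarith
  · have := (hk' _ h0.posSemidef).trans (mul_le_mul_of_nonneg_left (by linarith : T1 ≤ 4 * C) hk)
    linarith
  · rw [← Real.le_log_iff_exp_le h0.det_pos]
    linarith
  · rw [← Real.le_log_iff_exp_le hT.det_pos]
    linarith

/-- The objective bounds only `v`, `Y` and the initial moments. Later means and covariances are
continuous images of earlier data under the dynamics, and `S` is controlled by the matrix
inequality. -/
theorem Data.compactRangeOn_sublevel (D : Data d d' N) (hD : D.Valid) (c : ℝ) :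
    CompactRangeOn (D.sublevel c) (id : SDPTuple d d' N → SDPTuple d d' N) := by
  obtain ⟨R, hR⟩ := D.exists_bound_sublevel hD c
  have hv : ∀ t, CompactRangeOn (D.sublevel c) (fun x => x.2.1 t) := fun t =>
    compactRangeOn_of_norm_sq_le R fun x hx => (hR x hx).1 t
  have hY : ∀ t, CompactRangeOn (D.sublevel c) (fun x => x.2.2.2 t) := fun t =>
    compactRangeOn_of_abs_entry_le R fun x hx i j => by
      have hY : (x.2.2.2 t).PosSemidef := (hx.1.lmi t).submatrix Sum.inl
      exact (hY.abs_entry_le_trace i j).trans ((hR x hx).2.1 t)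
  have hm : ∀ t, CompactRangeOn (D.sublevel c) (fun x => x.1.1 t) := fun t => by
    induction t using Fin.induction with
    | zero => exact compactRangeOn_of_norm_sq_le R fun x hx => (hR x hx).2.2.1
    | succ t ih =>
      refine CompactRangeOn.congr ((ih.prodMk (hv t)).comp
        (h := fun p => Matrix.toEuclideanLin D.A p.1 + Matrix.toEuclideanLin D.B p.2) ?_)
        fun x hx => hx.1.mean t
      exact ((LinearMap.continuous_of_finiteDimensional _).comp continuous_fst).add
        ((LinearMap.continuous_of_finiteDimensional _).comp continuous_snd)
  -- An entry of `S t` is an entry of the block matrix, hence at most `tr Y t + tr Σ t`.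
  have hSC : ∀ t : Fin N, CompactRangeOn (D.sublevel c) (fun x => x.1.2 t.castSucc) →
      CompactRangeOn (D.sublevel c) (fun x => x.2.2.1 t) := fun t ⟨K, hK, hs⟩ => by
    obtain ⟨r, hr⟩ := (hK.image_of_continuousOn (f := Matrix.trace)
      (by fun_prop : Continuous (Matrix.trace : Matrix (Fin d) (Fin d) ℝ → ℝ)).continuousOn).bddAbove
    refine compactRangeOn_of_abs_entry_le (R + r) fun x hx i j => ?_
    have h1 := (hx.1.lmi t).abs_entry_le_trace (Sum.inl i) (Sum.inr j)
    rw [Matrix.trace, Fintype.sum_sum_type] at h1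
    have h2 := (hR x hx).2.1 t
    have h3 := hr ⟨_, hs x hx, rfl⟩
    exact h1.trans (add_le_add h2 h3)
  have hC : ∀ t, CompactRangeOn (D.sublevel c) (fun x => x.1.2 t) := fun t => by
    induction t using Fin.induction with
    | zero =>
      exact compactRangeOn_of_abs_entry_le R fun x hx i j =>
        ((hx.1.cov 0).abs_entry_le_trace i j).trans ((hR x hx).2.2.2.1)
    | succ t ih =>
      refine CompactRangeOn.congr (((ih.prodMk (hSC t ih)).prodMk (hY t)).comp
        (h := fun p => D.A * p.1.1 * D.Aᵀ + D.B * p.1.2 * D.Aᵀ + D.A * p.1.2ᵀ * D.Bᵀ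
          + D.B * p.2 * D.Bᵀ) (by fun_prop)) fun x hx => hx.1.covDyn t
  exact ((CompactRangeOn.pi hm).prodMk (CompactRangeOn.pi hC)).prodMk
    ((CompactRangeOn.pi hv).prodMk ((CompactRangeOn.pi fun t => hSC t (hC _)).prodMk
      (CompactRangeOn.pi hY)))

theorem Data.isClosed_feasible (D : Data d d' N) :
    IsClosed {x : SDPTuple d d' N | D.SDPFeasible (.ofTuple x)} := by
  have : {x : SDPTuple d d' N | D.SDPFeasible (.ofTuple x)}
      = ((⋂ t : Fin N, {x : SDPTuple d d' N | x.1.1 t.succ = Matrix.toEuclideanLin D.A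
          (x.1.1 t.castSucc) + Matrix.toEuclideanLin D.B (x.2.1 t)}) ∩
        (⋂ t : Fin N, {x : SDPTuple d d' N | x.1.2 t.succ = D.A * x.1.2 t.castSucc * D.Aᵀ
          + D.B * x.2.2.1 t * D.Aᵀ + D.A * (x.2.2.1 t)ᵀ * D.Bᵀ + D.B * x.2.2.2 t * D.Bᵀ})) ∩
        ((⋂ t : Fin N, (fun x : SDPTuple d d' N => Matrix.fromBlocks (x.2.2.2 t) (x.2.2.1 t)
          (x.2.2.1 t)ᵀ (x.1.2 t.castSucc)) ⁻¹' {M | M.PosSemidef}) ∩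
        ⋂ t, (fun x : SDPTuple d d' N => x.1.2 t) ⁻¹' {M | M.PosSemidef}) := by
    ext x
    simp only [Set.mem_inter_iff, Set.mem_iInter]
    exact ⟨fun h => ⟨⟨h.mean, h.covDyn⟩, h.lmi, h.cov⟩, fun h => ⟨h.1.1, h.1.2, h.2.1, h.2.2⟩⟩
  rw [this]
  refine ((isClosed_iInter fun t => isClosed_eq (by fun_prop) (Continuous.add ?_ ?_)).inter
    (isClosed_iInter fun t => isClosed_eq (by fun_prop) (by fun_prop))).inter
    ((isClosed_iInter fun t => isClosed_posSemidef.preimage ?_).inter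
      (isClosed_iInter fun t => isClosed_posSemidef.preimage (by fun_prop)))
  · exact (LinearMap.continuous_of_finiteDimensional _).comp (by fun_prop)
  · exact (LinearMap.continuous_of_finiteDimensional _).comp (by fun_prop)
  · exact Continuous.matrix_fromBlocks (by fun_prop) (by fun_prop) (by fun_prop) (by fun_prop)

/-- The uncontrolled evolution of `𝒩(0, I)` is a feasible point with finite objective. -/
theorem Data.exists_feasible (D : Data d d' N) (hD : D.Valid) :
    ∃ x : SDPTuple d d' N, D.SDPFeasible (.ofTuple x) ∧ (x.1.2 0).PosDef ∧
      (x.1.2 (Fin.last N)).PosDef := by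
  -- Nonsingularity of `A` keeps these covariances positive definite up to the final time.
  let C : Fin (N + 1) → Matrix (Fin d) (Fin d) ℝ := fun t => D.A ^ (t : ℕ) * (D.A ^ (t : ℕ))ᵀ
  have hC : ∀ t, (C t).PosDef := fun t => by
    have h : (C t).PosSemidef := by
      simpa [C] using posSemidef_self_mul_conjTranspose (D.A ^ (t : ℕ))
    rw [h.posDef_iff_det_ne_zero]
    simp [C, det_mul, hD.A_nonsing]
  refine ⟨((0, C), 0, 0, 0), ⟨fun t => ?_, fun t => ?_, fun t => ?_, fun t => (hC t).posSemidef⟩,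
    hC _, hC _⟩
  · simp [SDPVar.ofTuple]
  · simp [SDPVar.ofTuple, C, pow_succ' D.A, pow_succ D.Aᵀ, Matrix.mul_assoc]
  -- With zero control the block matrix is the congruence of `C t` by the column `[0; 1]`.
  · simp only [SDPVar.ofTuple, Pi.zero_apply, transpose_zero]
    have e : fromBlocks (0 : Matrix (Fin d') (Fin d') ℝ) 0 0 (C t.castSucc)
        = fromRows (0 : Matrix (Fin d') (Fin d) ℝ) (1 : Matrix (Fin d) (Fin d) ℝ) * C t.castSucc
          * (fromRows (0 : Matrix (Fin d') (Fin d) ℝ) (1 : Matrix (Fin d) (Fin d) ℝ))ᵀ := by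
      rw [fromRows_mul, transpose_fromRows, fromRows_mul_fromCols]
      simp
    rw [e]
    exact (hC _).posSemidef.congr_right _

theorem Data.sdpObjective_eq {D : Data d d' N} {z : SDPVar d d' N} (h0 : (z.cov 0).PosDef)
    (hT : (z.cov (Fin.last N)).PosDef) : D.sdpObjective z = (D.sdpReal z : EReal) := by
  rw [Data.sdpObjective, if_pos ⟨h0, hT⟩, Data.sdpReal]

/-- The SDP has a solution, with positive definite end covariances. -/
theorem Data.exists_sdp_min (D : Data d d' N) (hD : D.Valid) :
    ∃ z : SDPVar d d' N, D.SDPFeasible z ∧ (z.cov 0).PosDef ∧ (z.cov (Fin.last N)).PosDef ∧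
      ∀ z', D.SDPFeasible z' → (z'.cov 0).PosDef → (z'.cov (Fin.last N)).PosDef →
        D.sdpReal z ≤ D.sdpReal z' := by
  obtain ⟨x₀, hx₀, h₀, hT₀⟩ := D.exists_feasible hD
  set c := D.sdpReal (.ofTuple x₀) with hc
  obtain ⟨K, hK, hKs⟩ := D.compactRangeOn_sublevel hD c
  obtain ⟨R, hR⟩ := D.exists_bound_sublevel hD c
  -- Positive definiteness is not a closed condition. Lower bounds on the determinants are, and they
  -- also keep `log det` continuous. The set may exceed the sublevel set, which does no harm as it
  -- consists of feasible points with nonsingular end covariances.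
  set A : Set (SDPTuple d d' N) := K ∩ ({x | D.SDPFeasible (.ofTuple x)} ∩
    ({x | Real.exp (-R) ≤ (x.1.2 0).det} ∩ {x | Real.exp (-R) ≤ (x.1.2 (Fin.last N)).det})) with hA
  have hsub : D.sublevel c ⊆ A := fun x hx =>
    ⟨hKs x hx, hx.1, (hR x hx).2.2.2.2.1, (hR x hx).2.2.2.2.2⟩
  have hAc : IsCompact A := by
    refine hK.inter_right (D.isClosed_feasible.inter (IsClosed.inter ?_ ?_))
    · exact isClosed_le continuous_const (by fun_prop)
    · exact isClosed_le continuous_const (by fun_prop)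
  have hpos : ∀ x ∈ A, (x.1.2 0).det ≠ 0 ∧ (x.1.2 (Fin.last N)).det ≠ 0 := fun x hx =>
    ⟨((Real.exp_pos _).trans_le hx.2.2.1).ne', ((Real.exp_pos _).trans_le hx.2.2.2).ne'⟩
  have hcont : ContinuousOn (fun x : SDPTuple d d' N => D.sdpReal (.ofTuple x)) A := by
    unfold Data.sdpReal Data.M Data.covTerm SDPVar.ofTuple
    refine ((Continuous.continuousOn (by fun_prop)).add
      (Continuous.continuousOn (by fun_prop))).add (ContinuousOn.mul continuousOn_const
        (ContinuousOn.mul continuousOn_const (ContinuousOn.sub (ContinuousOn.sub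
          (Continuous.continuousOn (by fun_prop)) ?_) ?_)))
    · exact ContinuousOn.log (Continuous.continuousOn (by fun_prop)) fun x hx => (hpos x hx).1
    · exact ContinuousOn.log (Continuous.continuousOn (by fun_prop)) fun x hx => (hpos x hx).2
  have hx₀A : x₀ ∈ A := hsub ⟨hx₀, h₀, hT₀, le_rfl⟩
  obtain ⟨x, hxA, hx⟩ := hAc.exists_isMinOn ⟨x₀, hx₀A⟩ hcont
  have hF : D.SDPFeasible (.ofTuple x) := hxA.2.1
  refine ⟨.ofTuple x, hF, ?_, ?_, fun z' hz' h0' hT' => ?_⟩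
  · exact (hF.cov 0).posDef_iff_det_ne_zero.2 (hpos x hxA).1
  · exact (hF.cov _).posDef_iff_det_ne_zero.2 (hpos x hxA).2
  -- A competitor above level `c` is beaten by `x₀`, which lies in the compact set.
  · rcases le_total (D.sdpReal z') c with h | h
    · exact isMinOn_iff.1 hx ((z'.m, z'.cov), z'.v, z'.S, z'.Y) (hsub ⟨hz', h0', hT', h⟩)
    · exact (isMinOn_iff.1 hx x₀ hx₀A).trans h

/-- The optimal value of the SDP is a real number, which is attained; the end covariances of every
solution are positive definite. -/
theorem Data.exists_sdpValue (D : Data d d' N) (hD : D.Valid) :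
    ∃ p : ℝ, D.sdpValue = (p : EReal) ∧ (∃ z, D.IsSDPSolution z) ∧
      (∀ z, D.IsSDPSolution z → (z.cov 0).PosDef ∧ (z.cov (Fin.last N)).PosDef ∧
        D.sdpReal z = p) ∧
      ∀ z, D.SDPFeasible z → (z.cov 0).PosDef → (z.cov (Fin.last N)).PosDef → p ≤ D.sdpReal z := by
  obtain ⟨z, hz, h0, hT, hmin⟩ := D.exists_sdp_min hD
  have hval : D.sdpValue = (D.sdpReal z : EReal) := by
    refine le_antisymm ((iInf₂_le z hz).trans_eq (D.sdpObjective_eq h0 hT))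
      (le_iInf₂ fun z' hz' => ?_)
    by_cases h : (z'.cov 0).PosDef ∧ (z'.cov (Fin.last N)).PosDef
    · rw [D.sdpObjective_eq h.1 h.2]
      exact_mod_cast hmin z' hz' h.1 h.2
    · rw [Data.sdpObjective, if_neg h]
      exact le_top
  refine ⟨D.sdpReal z, hval, ⟨z, hz, by rw [hval, D.sdpObjective_eq h0 hT]⟩,
    fun z' hz' => ?_, hmin⟩
  have h2 := hz'.2
  rw [hval] at h2
  by_cases h : (z'.cov 0).PosDef ∧ (z'.cov (Fin.last N)).PosDef
  · rw [D.sdpObjective_eq h.1 h.2] at h2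
    exact ⟨h.1, h.2, by exact_mod_cast h2⟩
  · rw [Data.sdpObjective, if_neg h] at h2
    exact absurd h2.symm (EReal.coe_ne_top _)

end Existence

/-! ### First and second moments -/

section Moments

open Matrix

variable {Ω ι κ : Type*} {mΩ : MeasurableSpace Ω} {μ : Measure Ω}

/-- The covariance matrix of a family of real random variables. -/
noncomputable def covMat (X : ι → Ω → ℝ) (μ : Measure Ω) : Matrix ι ι ℝ :=
  Matrix.of fun i j => cov[X i, X j; μ]

theorem covMat_transpose (X : ι → Ω → ℝ) : (covMat X μ)ᵀ = covMat X μ := by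
  ext i j
  exact covariance_comm _ _

theorem covMat_map {Ω' : Type*} {mΩ' : MeasurableSpace Ω'} {X : ι → Ω' → ℝ}
    (hX : ∀ i, Measurable (X i)) {f : Ω → Ω'} (hf : Measurable f) :
    covMat X (μ.map f) = covMat (fun i ω => X i (f ω)) μ := by
  ext i j
  exact covariance_map (hX i).aestronglyMeasurable (hX j).aestronglyMeasurable hf.aemeasurable

variable [Fintype ι]

theorem covMat_linear [IsProbabilityMeasure μ] {X : ι → Ω → ℝ} (hX : ∀ i, MemLp (X i) 2 μ)
    (C : Matrix κ ι ℝ) :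
    covMat (fun k ω => ∑ i, C k i * X i ω) μ = C * covMat X μ * Cᵀ := by
  ext k l
  have h : ∀ k i, MemLp (fun ω => C k i * X i ω) 2 μ := fun k i => (hX i).const_mul _
  simp only [covMat, of_apply, mul_apply, transpose_apply]
  rw [covariance_fun_sum_fun_sum (h k) (h l), Finset.sum_comm]
  simp_rw [covariance_const_mul_left, covariance_const_mul_right, Finset.sum_mul]
  exact Finset.sum_congr rfl fun i _ => Finset.sum_congr rfl fun j _ => by ring

/-- The quadratic form at `x` is the variance of `∑ i, x i * X i`. -/
theorem covMat_posSemidef [IsProbabilityMeasure μ] {X : ι → Ω → ℝ} (hX : ∀ i, MemLp (X i) 2 μ) :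
    (covMat X μ).PosSemidef := by
  refine posSemidef_of_real (covMat_transpose X) fun x => ?_
  have h := congrFun (congrFun (covMat_linear hX (Matrix.of fun (_ : Unit) i => x i)) ()) ()
  have e : x ⬝ᵥ covMat X μ *ᵥ x = cov[fun ω => ∑ i, x i * X i ω, fun ω => ∑ i, x i * X i ω; μ] := by
    refine Eq.trans ?_ h.symm
    rw [dotProduct_mulVec]
    rfl
  have hm : AEMeasurable (fun ω => ∑ i, x i * X i ω) μ :=
    (memLp_finsetSum Finset.univ fun i _ => (hX i).const_mul (x i)).aestronglyMeasurable.aemeasurable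
  rw [e, covariance_self hm]
  exact variance_nonneg _ _

theorem memLp_two_of_lintegral {k : ℕ} {f : Ω → E k} (hf : Measurable f)
    (h : ∫⁻ ω, ‖f ω‖ₑ ^ 2 ∂μ < ∞) : MemLp f 2 μ := by
  refine ⟨hf.aestronglyMeasurable, ?_⟩
  rw [eLpNorm_lt_top_iff_lintegral_rpow_enorm_lt_top (by norm_num) (by norm_num)]
  simpa using h

theorem memLp_apply {k : ℕ} {f : Ω → E k} (hf : MemLp f 2 μ) (i : Fin k) :
    MemLp (fun ω => f ω i) 2 μ :=
  (EuclideanSpace.proj (𝕜 := ℝ) i).comp_memLp' hf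

/-- The mean of a measure on Euclidean space. -/
noncomputable def meanOf {k : ℕ} (P : Measure (E k)) : E k :=
  WithLp.toLp 2 fun i => ∫ x, x i ∂P

/-- The covariance matrix of a measure on Euclidean space. -/
noncomputable def covOf {k : ℕ} (P : Measure (E k)) : Matrix (Fin k) (Fin k) ℝ :=
  covMat (fun i x => x i) P

theorem MemM2.memLp_id {k : ℕ} {P : Measure (E k)} (hP : MemM2 P) : MemLp id 2 P :=
  memLp_two_of_lintegral measurable_id hP.2

theorem covOf_posSemidef {k : ℕ} {P : Measure (E k)} [IsProbabilityMeasure P]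
    (hP : MemLp id 2 P) : (covOf P).PosSemidef :=
  covMat_posSemidef fun i => memLp_apply hP i

/-- Expectation of a quadratic form. -/
theorem integral_quad {k : ℕ} {P : Measure (E k)} [IsProbabilityMeasure P] (hP : MemLp id 2 P)
    (M : Matrix (Fin k) (Fin k) ℝ) (a : E k) :
    Integrable (fun x : E k => (x - a).ofLp ⬝ᵥ (M *ᵥ (x - a).ofLp)) P ∧
    ∫ x, (x - a).ofLp ⬝ᵥ (M *ᵥ (x - a).ofLp) ∂P
      = (M * covOf P).trace + (meanOf P - a).ofLp ⬝ᵥ (M *ᵥ (meanOf P - a).ofLp) := by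
  have hX : ∀ i, MemLp (fun x : E k => x i) 2 P := fun i => memLp_apply hP i
  have hXi : ∀ i, Integrable (fun x : E k => x i) P := fun i => (hX i).integrable (by norm_num)
  have hX' : ∀ i, MemLp (fun x : E k => x i - a i) 2 P := fun i => (hX i).sub (memLp_const _)
  have hint : ∀ i j, Integrable (fun x : E k => (x i - a i) * (x j - a j)) P := fun i j =>
    (hX' i).integrable_mul (hX' j)
  -- The index order `j i` is the one in which the covariance appears in `tr (M * covOf P)`.
  have hval : ∀ i j, ∫ x : E k, (x i - a i) * (x j - a j) ∂P
      = covOf P j i + (meanOf P i - a i) * (meanOf P j - a j) := by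
    intro i j
    have h := covariance_eq_sub (hX' i) (hX' j)
    rw [covariance_sub_const_left (hXi i), covariance_sub_const_right (hXi j),
      integral_sub (hXi i) (integrable_const _), integral_sub (hXi j) (integrable_const _)] at h
    simp only [Pi.mul_apply, integral_const, probReal_univ, one_smul] at h
    have hc : covOf P j i = cov[fun x : E k => x i, fun x => x j; P] := covariance_comm _ _
    rw [hc, h]
    simp [meanOf]
  obtain ⟨c, hc⟩ : ∃ c : Fin k → Fin k → ℝ, ∀ i j, M i j = c i j :=
    ⟨fun i j => M i j, fun _ _ => rfl⟩
  have hexp : ∀ y : Fin k → ℝ, y ⬝ᵥ (M *ᵥ y) = ∑ i, ∑ j, c i j * (y i * y j) := fun y => by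
    simp only [dotProduct, mulVec, Finset.mul_sum, hc]
    exact Finset.sum_congr rfl fun i _ => Finset.sum_congr rfl fun j _ => by ring
  simp only [hexp, WithLp.ofLp_sub, Pi.sub_apply]
  refine ⟨integrable_finsetSum _ fun i _ => integrable_finsetSum _ fun j _ =>
    (hint i j).const_mul _, ?_⟩
  rw [integral_finsetSum _ fun i _ => integrable_finsetSum _ fun j _ => (hint i j).const_mul _]
  simp_rw [trace, diag_apply, mul_apply, hc, ← Finset.sum_add_distrib]
  refine Finset.sum_congr rfl fun i _ => ?_
  rw [integral_finsetSum _ fun j _ => (hint i j).const_mul _]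
  refine Finset.sum_congr rfl fun j _ => ?_
  rw [integral_const_mul, hval, mul_add]

/-- The quadratic-form identity with matrix `1` and centre `0`. -/
theorem lintegral_enorm_sq {k : ℕ} {P : Measure (E k)} [IsProbabilityMeasure P]
    (hP : MemLp id 2 P) :
    ∫⁻ x, ‖x‖ₑ ^ 2 ∂P = ENNReal.ofReal (‖meanOf P‖ ^ 2 + (covOf P).trace) := by
  have hsq : ∀ x : E k, x.ofLp ⬝ᵥ ((1 : Matrix (Fin k) (Fin k) ℝ) *ᵥ x.ofLp) = ‖x‖ ^ 2 :=
    fun x => by rw [one_mulVec, EuclideanSpace.real_norm_sq_eq]; simp [dotProduct, sq]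
  have h := integral_quad hP 1 0
  simp only [sub_zero, hsq, Matrix.one_mul] at h
  rw [add_comm, ← h.2, ofReal_integral_eq_lintegral_ofReal h.1 (ae_of_all _ fun x => by positivity)]
  refine lintegral_congr fun x => ?_
  rw [ENNReal.ofReal_pow (norm_nonneg _), ofReal_norm]

end Moments

/-! ### Moments along the controlled dynamics -/

section Dynamics

open Matrix

variable {d d' N : ℕ} (D : Data d d' N)

theorem Data.measurable_step : Measurable D.step := by
  have hA := (LinearMap.continuous_of_finiteDimensional (Matrix.toEuclideanLin D.A)).measurable
  have hB := (LinearMap.continuous_of_finiteDimensional (Matrix.toEuclideanLin D.B)).measurable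
  exact (hA.comp measurable_fst).add (hB.comp measurable_snd)

theorem Data.step_apply (p : E d × E d') (i : Fin d) :
    D.step p i = ∑ j, D.A i j * p.1 j + ∑ j, D.B i j * p.2 j := by
  simp [Data.step, Matrix.toLpLin_apply, mulVec, dotProduct]

/-- Control and state coordinates on the product space. -/
def coords (d d' : ℕ) : Fin d' ⊕ Fin d → E d × E d' → ℝ :=
  Sum.elim (fun i p => p.2 i) (fun j p => p.1 j)

/-- The cross covariance of control and state. -/
noncomputable def crossCov {d d' : ℕ} (ρ : Measure (E d × E d')) : Matrix (Fin d') (Fin d) ℝ :=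
  Matrix.of fun i j => cov[fun p => p.2 i, fun p => p.1 j; ρ]

/-- Since control coordinates come first, the joint covariance is literally the block matrix of the
SDP constraint; that constraint is therefore just positivity of a covariance. -/
theorem covMat_coords (ρ : Measure (E d × E d')) :
    covMat (coords d d') ρ
      = fromBlocks (covOf ρ.snd) (crossCov ρ) (crossCov ρ)ᵀ (covOf ρ.fst) := by
  have h1 : covOf ρ.snd = covMat (fun i p => p.2 i) ρ :=
    covMat_map (fun i => by fun_prop) measurable_snd
  have h2 : covOf ρ.fst = covMat (fun i p => p.1 i) ρ :=
    covMat_map (fun i => by fun_prop) measurable_fst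
  rw [h1, h2]
  ext (i | i) (j | j)
  · rfl
  · rfl
  · exact covariance_comm _ _
  · rfl

variable {ρ : Measure (E d × E d')}

theorem memLp_coords (h1 : MemLp Prod.fst 2 ρ) (h2 : MemLp Prod.snd 2 ρ) (i : Fin d' ⊕ Fin d) :
    MemLp (coords d d' i) 2 ρ := by
  rcases i with i | i
  · exact memLp_apply h2 i
  · exact memLp_apply h1 i

variable [IsProbabilityMeasure ρ]

/-- The step is the linear map `[B A]` on the pair (control, state), so the new covariance is `[B A]
* Cov * [B A]ᵀ`, expanded by blocks. -/
theorem Data.covOf_map_step (h1 : MemLp Prod.fst 2 ρ) (h2 : MemLp Prod.snd 2 ρ) :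
    covOf (ρ.map D.step) = D.A * covOf ρ.fst * D.Aᵀ + D.B * crossCov ρ * D.Aᵀ
      + D.A * (crossCov ρ)ᵀ * D.Bᵀ + D.B * covOf ρ.snd * D.Bᵀ := by
  have h := covMat_linear (memLp_coords h1 h2) (fromCols D.B D.A)
  have e : covOf (ρ.map D.step)
      = covMat (fun k ω => ∑ i, fromCols D.B D.A k i * coords d d' i ω) ρ := by
    rw [covOf, covMat_map (fun i => by fun_prop) D.measurable_step]
    congr 1
    funext i p
    rw [D.step_apply, Fintype.sum_sum_type, add_comm]
    rfl
  rw [e, h, covMat_coords, fromCols_mul_fromBlocks, transpose_fromCols, fromCols_mul_fromRows]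
  simp only [Matrix.add_mul]
  abel

theorem Data.meanOf_map_step (h1 : MemLp Prod.fst 2 ρ) (h2 : MemLp Prod.snd 2 ρ) :
    meanOf (ρ.map D.step) = Matrix.toEuclideanLin D.A (meanOf ρ.fst)
      + Matrix.toEuclideanLin D.B (meanOf ρ.snd) := by
  have i1 : ∀ j, Integrable (fun p : E d × E d' => p.1 j) ρ := fun j =>
    (memLp_apply h1 j).integrable (by norm_num)
  have i2 : ∀ j, Integrable (fun p : E d × E d' => p.2 j) ρ := fun j =>
    (memLp_apply h2 j).integrable (by norm_num)
  have e1 : ∀ j, meanOf ρ.fst j = ∫ p, p.1 j ∂ρ := fun j =>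
    integral_map measurable_fst.aemeasurable (Measurable.aestronglyMeasurable (by fun_prop))
  have e2 : ∀ j, meanOf ρ.snd j = ∫ p, p.2 j ∂ρ := fun j =>
    integral_map measurable_snd.aemeasurable (Measurable.aestronglyMeasurable (by fun_prop))
  ext i
  have e : meanOf (ρ.map D.step) i = ∫ p, D.step p i ∂ρ :=
    integral_map D.measurable_step.aemeasurable (Measurable.aestronglyMeasurable (by fun_prop))
  rw [e]
  simp_rw [D.step_apply]
  rw [integral_add (integrable_finsetSum _ fun j _ => (i1 j).const_mul _)
    (integrable_finsetSum _ fun j _ => (i2 j).const_mul _),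
    integral_finsetSum _ fun j _ => (i1 j).const_mul _,
    integral_finsetSum _ fun j _ => (i2 j).const_mul _]
  simp [Matrix.toLpLin_apply, mulVec, dotProduct, integral_const_mul, e1, e2]

/-! ### State measures under a policy: finiteness, scaling, moments. -/

theorem Data.stateMeasure_zero (π₁ : Measure (E d)) (U : Fin N → Kernel (E d) (E d')) :
    D.stateMeasure π₁ U 0 = π₁ := rfl

theorem Data.stateMeasure_succ (π₁ : Measure (E d)) (U : Fin N → Kernel (E d) (E d'))
    (t : Fin N) : D.stateMeasure π₁ U t.succ
      = ((D.stateMeasure π₁ U t.castSucc) ⊗ₘ U t).map D.step := rfl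

theorem Data.isFiniteMeasure_stateMeasure (π₁ : Measure (E d)) [IsFiniteMeasure π₁]
    (U : Fin N → Kernel (E d) (E d')) (hU : ∀ t, IsMarkovKernel (U t)) (t : Fin (N + 1)) :
    IsFiniteMeasure (D.stateMeasure π₁ U t) := by
  induction t using Fin.induction with
  | zero => rwa [D.stateMeasure_zero]
  | succ t ih =>
    have := hU t
    rw [D.stateMeasure_succ]
    infer_instance

theorem Data.isProbabilityMeasure_stateMeasure (π₁ : Measure (E d)) [IsProbabilityMeasure π₁]
    (U : Fin N → Kernel (E d) (E d')) (hU : ∀ t, IsMarkovKernel (U t)) (t : Fin (N + 1)) :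
    IsProbabilityMeasure (D.stateMeasure π₁ U t) := by
  induction t using Fin.induction with
  | zero => rwa [D.stateMeasure_zero]
  | succ t ih =>
    have := hU t
    rw [D.stateMeasure_succ]
    exact Measure.isProbabilityMeasure_map D.measurable_step.aemeasurable

/-- The dynamics are linear in the initial measure. This permits normalizing to a probability
measure without changing the policy. -/
theorem Data.stateMeasure_smul (c : ℝ≥0∞) (π₁ : Measure (E d)) [IsFiniteMeasure π₁]
    (U : Fin N → Kernel (E d) (E d')) (hU : ∀ t, IsMarkovKernel (U t)) (t : Fin (N + 1)) :
    D.stateMeasure (c • π₁) U t = c • D.stateMeasure π₁ U t := by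
  induction t using Fin.induction with
  | zero => rfl
  | succ t ih =>
    have := hU t
    have := D.isFiniteMeasure_stateMeasure π₁ U hU t.castSucc
    rw [D.stateMeasure_succ, D.stateMeasure_succ, ih, Measure.compProd_smul_left, Measure.map_smul]

theorem Data.controlEnergy_smul (c : ℝ≥0∞) (π₁ : Measure (E d)) [IsFiniteMeasure π₁]
    (U : Fin N → Kernel (E d) (E d')) (hU : ∀ t, IsMarkovKernel (U t)) :
    D.controlEnergy (c • π₁) U = c * D.controlEnergy π₁ U := by
  simp only [Data.controlEnergy, D.stateMeasure_smul c π₁ U hU, lintegral_smul_measure,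
    Finset.mul_sum, smul_eq_mul]

/-- The energy sees only the control marginal, hence only its mean and covariance. -/
theorem lintegral_control {P : Measure (E d)} [IsFiniteMeasure P] {U : Kernel (E d) (E d')}
    [IsMarkovKernel U] :
    ∫⁻ x, ∫⁻ u, ‖u‖ₑ ^ 2 ∂(U x) ∂P = ∫⁻ u, ‖u‖ₑ ^ 2 ∂(P ⊗ₘ U).snd := by
  rw [Measure.snd, lintegral_map (by fun_prop) measurable_snd,
    Measure.lintegral_compProd (f := fun p : E d × E d' => ‖p.2‖ₑ ^ 2) (by fun_prop)]

/-- The moments of an admissible pair. -/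
noncomputable def Data.moments (P : Measure (E d)) (U : Fin N → Kernel (E d) (E d')) :
    SDPVar d d' N where
  m t := meanOf (D.stateMeasure P U t)
  cov t := covOf (D.stateMeasure P U t)
  v t := meanOf ((D.stateMeasure P U t.castSucc) ⊗ₘ U t).snd
  S t := crossCov ((D.stateMeasure P U t.castSucc) ⊗ₘ U t)
  Y t := covOf ((D.stateMeasure P U t.castSucc) ⊗ₘ U t).snd

variable {P : Measure (E d)} {U : Fin N → Kernel (E d) (E d')}

theorem Data.Admissible.memLp_snd {D : Data d d' N} (h : D.Admissible P U) (t : Fin N) :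
    MemLp Prod.snd 2 ((D.stateMeasure P U t.castSucc) ⊗ₘ U t) := by
  have := h.markov t
  have := (h.memM2 t.castSucc).1
  have h1 := (ENNReal.sum_lt_top.1 h.energy) t (Finset.mem_univ t)
  rw [lintegral_control, Measure.snd, lintegral_map (by fun_prop) measurable_snd] at h1
  exact memLp_two_of_lintegral measurable_snd h1

theorem Data.Admissible.memLp_fst {D : Data d d' N} (h : D.Admissible P U) (t : Fin N) :
    MemLp Prod.fst 2 ((D.stateMeasure P U t.castSucc) ⊗ₘ U t) := by
  have := h.markov t
  have := (h.memM2 t.castSucc).1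
  have h1 := (h.memM2 t.castSucc).2
  rw [← Measure.fst_compProd (D.stateMeasure P U t.castSucc) (U t), Measure.fst,
    lintegral_map (by fun_prop) measurable_fst] at h1
  exact memLp_two_of_lintegral measurable_fst h1

variable [IsProbabilityMeasure P]

/-- The moments of an admissible pair are feasible for the lifted SDP. -/
theorem Data.Admissible.feasible_moments {D : Data d d' N} (h : D.Admissible P U) :
    D.SDPFeasible (D.moments P U) := by
  have hp := D.isProbabilityMeasure_stateMeasure P U h.markov
  have hm := h.markov
  refine ⟨fun t => ?_, fun t => ?_, fun t => ?_, fun t => covOf_posSemidef (h.memM2 t).memLp_id⟩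
  · have := D.meanOf_map_step (h.memLp_fst t) (h.memLp_snd t)
    rwa [Measure.fst_compProd] at this
  · have := D.covOf_map_step (h.memLp_fst t) (h.memLp_snd t)
    rwa [Measure.fst_compProd] at this
  · have := covMat_posSemidef (memLp_coords (h.memLp_fst t) (h.memLp_snd t))
    rwa [covMat_coords, Measure.fst_compProd] at this

/-- The second moment of each control is `‖mean‖² + tr cov`; passing to moments loses nothing in the
energy. -/
theorem Data.Admissible.controlEnergy_eq {D : Data d d' N} (h : D.Admissible P U) :
    D.controlEnergy P U = ENNReal.ofReal
      (∑ t, (‖(D.moments P U).v t‖ ^ 2 + ((D.moments P U).Y t).trace)) := by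
  have hp := D.isProbabilityMeasure_stateMeasure P U h.markov
  have hm := h.markov
  rw [Data.controlEnergy, ENNReal.ofReal_sum_of_nonneg fun t _ =>
    add_nonneg (sq_nonneg _) (SDPVar.trace_Y_nonneg h.feasible_moments t)]
  refine Finset.sum_congr rfl fun t _ => ?_
  rw [lintegral_control, lintegral_enorm_sq]
  · rfl
  · rw [Measure.snd, memLp_map_measure_iff (by fun_prop) (by fun_prop)]
    exact h.memLp_snd t

end Dynamics

/-! ### Gaussian measures: moments, affine images and densities -/

section Gaussian

open Matrix

variable {k l : ℕ}

theorem memLp_id_multivariateGaussian (m : E k) (S : Matrix (Fin k) (Fin k) ℝ) :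
    MemLp id 2 (multivariateGaussian m S) :=
  IsGaussian.memLp_two_id

theorem meanOf_eq_integral {P : Measure (E k)} [IsFiniteMeasure P] (hP : MemLp id 2 P) :
    meanOf P = ∫ x, x ∂P := by
  ext i
  have := (EuclideanSpace.proj (𝕜 := ℝ) i).integral_comp_comm (hP.integrable (by norm_num))
  exact this

theorem meanOf_multivariateGaussian (m : E k) (S : Matrix (Fin k) (Fin k) ℝ) :
    meanOf (multivariateGaussian m S) = m := by
  rw [meanOf_eq_integral (memLp_id_multivariateGaussian m S), integral_id_multivariateGaussian]

theorem covOf_multivariateGaussian (m : E k) {S : Matrix (Fin k) (Fin k) ℝ}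
    (hS : S.PosSemidef) : covOf (multivariateGaussian m S) = S := by
  ext i j
  exact covariance_eval_multivariateGaussian hS i j

/-- A Gaussian law is determined by its mean and covariance form, and the form need only be compared
on the standard basis. Affine images can then be identified by computing moments. -/
theorem eq_multivariateGaussian {P : Measure (E k)} [IsGaussian P] :
    P = multivariateGaussian (meanOf P) (covOf P) := by
  have hP : MemLp id 2 P := IsGaussian.memLp_two_id
  have hC := covOf_posSemidef hP
  apply IsGaussian.ext
  · simp only [id_eq, integral_id_multivariateGaussian]
    rw [meanOf_eq_integral hP]
  · rw [← ContinuousLinearMap.toBilinForm_inj]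
    refine LinearMap.BilinForm.ext_basis (EuclideanSpace.basisFun (Fin k) ℝ).toBasis fun i j => ?_
    rw [ContinuousLinearMap.toBilinForm_apply, ContinuousLinearMap.toBilinForm_apply,
      covarianceBilin_multivariateGaussian hC]
    have := covarianceBilin_apply_basisFun (μ := P) (X := fun i x => x i)
      (fun i => memLp_apply hP i) i j
    simp only [WithLp.toLp_ofLp, Measure.map_id'] at this
    simp only [OrthonormalBasis.coe_toBasis]
    rw [this]
    simp [covOf, covMat]

theorem multivariateGaussian_map_affine (m : E k) {S : Matrix (Fin k) (Fin k) ℝ}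
    (hS : S.PosSemidef) (b : E l) (C : Matrix (Fin l) (Fin k) ℝ) :
    (multivariateGaussian m S).map (fun x => b + Matrix.toEuclideanLin C x)
      = multivariateGaussian (b + Matrix.toEuclideanLin C m) (C * S * Cᵀ) := by
  set T : E k →L[ℝ] E l := LinearMap.toContinuousLinearMap (Matrix.toEuclideanLin C) with hT
  have hTm : Measurable (fun x : E k => b + T x) := by fun_prop
  have hT' : ∀ x, Matrix.toEuclideanLin C x = T x := fun x => rfl
  have hX := memLp_id_multivariateGaussian m S
  have hI : Integrable (fun x : E k => x) (multivariateGaussian m S) :=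
    hX.integrable (by norm_num)
  simp only [hT']
  have hg : IsGaussian ((multivariateGaussian m S).map (fun x => b + T x)) := by
    have : (multivariateGaussian m S).map (fun x => b + T x)
        = ((multivariateGaussian m S).map T).map (fun y => b + y) := by
      rw [Measure.map_map (by fun_prop) (by fun_prop)]
      rfl
    rw [this]
    infer_instance
  rw [eq_multivariateGaussian (P := (multivariateGaussian m S).map (fun x => b + T x))]
  congr 1
  · rw [meanOf_eq_integral IsGaussian.memLp_two_id, integral_map hTm.aemeasurable (by fun_prop),
      integral_add (integrable_const _) (T.integrable_comp hI), T.integral_comp_comm hI,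
      integral_const]
    simp
  · have hc : covOf ((multivariateGaussian m S).map (fun x => b + T x))
        = covMat (fun i x => ∑ j, C i j * x j) (multivariateGaussian m S) := by
      rw [covOf, covMat_map (fun i => by fun_prop) hTm]
      have e : ∀ i, (fun x : E k => (b + T x) i) = fun x => b i + ∑ j, C i j * x j := fun i => by
        funext x
        simp [hT, Matrix.toLpLin_apply, mulVec, dotProduct]
      ext i j
      simp only [covMat, of_apply, e]
      have hi : ∀ i, Integrable (fun x : E k => ∑ j, C i j * x j) (multivariateGaussian m S) :=
        fun i => integrable_finsetSum _ fun j _ =>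
          ((memLp_apply hX j).integrable (by norm_num)).const_mul _
      rw [covariance_const_add_left (hi i), covariance_const_add_right (hi j)]
    have h := covMat_linear (X := fun i (x : E k) => x i) (fun i => memLp_apply hX i) C
    have hS' : covMat (fun i (x : E k) => x i) (multivariateGaussian m S) = S :=
      covOf_multivariateGaussian m hS
    rw [hS'] at h
    exact hc.trans h

/-- Characteristic functions of independent summands multiply. No density is involved, so singular
covariances are allowed. -/
theorem multivariateGaussian_prod_map_add (m₁ m₂ : E k) {S₁ S₂ : Matrix (Fin k) (Fin k) ℝ}
    (h₁ : S₁.PosSemidef) (h₂ : S₂.PosSemidef) :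
    ((multivariateGaussian m₁ S₁).prod (multivariateGaussian m₂ S₂)).map (fun p => p.1 + p.2)
      = multivariateGaussian (m₁ + m₂) (S₁ + S₂) := by
  apply Measure.ext_of_charFun
  rw [charFun_map_add_prod_eq_mul]
  ext t
  rw [Pi.mul_apply, charFun_multivariateGaussian h₁, charFun_multivariateGaussian h₂,
    charFun_multivariateGaussian (h₁.add h₂), ← Complex.exp_add]
  congr 1
  rw [inner_add_right, add_mulVec, dotProduct_add]
  push_cast
  ring

/-- The law of `b + C X + D W` for independent Gaussian `X` and centered Gaussian `W`. -/
theorem gaussian_prod_map_affine {j : ℕ} (m : E k) {S : Matrix (Fin k) (Fin k) ℝ}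
    (hS : S.PosSemidef) {W : Matrix (Fin j) (Fin j) ℝ} (hW : W.PosSemidef) (b : E l)
    (C : Matrix (Fin l) (Fin k) ℝ) (D : Matrix (Fin l) (Fin j) ℝ) :
    ((multivariateGaussian m S).prod (multivariateGaussian 0 W)).map
        (fun p => b + Matrix.toEuclideanLin C p.1 + Matrix.toEuclideanLin D p.2)
      = multivariateGaussian (b + Matrix.toEuclideanLin C m) (C * S * Cᵀ + D * W * Dᵀ) := by
  have h1 := multivariateGaussian_map_affine m hS b C
  have h2 := multivariateGaussian_map_affine 0 hW (0 : E l) D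
  simp only [zero_add, map_zero] at h2
  have mC := (LinearMap.continuous_of_finiteDimensional (Matrix.toEuclideanLin C)).measurable
  have mD := (LinearMap.continuous_of_finiteDimensional (Matrix.toEuclideanLin D)).measurable
  have := multivariateGaussian_prod_map_add (b + Matrix.toEuclideanLin C m) 0
    (hS.congr_right C) (hW.congr_right D)
  rw [add_zero, ← h1, ← h2, Measure.map_prod_map _ _ (mC.const_add b) mD,
    Measure.map_map (by fun_prop) ((mC.const_add b).prodMap mD)] at this
  exact this

/-! ### Densities of nondegenerate Gaussian measures. -/

theorem withDensity_comp_map {α β : Type*} {mα : MeasurableSpace α} {mβ : MeasurableSpace β}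
    (μ : Measure α) {T : α → β} (hT : Measurable T) {f : β → ℝ≥0∞} (hf : Measurable f) :
    (μ.withDensity (f ∘ T)).map T = (μ.map T).withDensity f := by
  ext s hs
  rw [Measure.map_apply hT hs, withDensity_apply _ (hT hs), withDensity_apply _ hs,
    setLIntegral_map hs hf hT]
  rfl

/-- The logarithm of the density of `𝒩(m, S)`. -/
noncomputable def logDensity (m : E k) (S : Matrix (Fin k) (Fin k) ℝ) (x : E k) : ℝ :=
  -(1 / 2) * ((x - m).ofLp ⬝ᵥ (S⁻¹ *ᵥ (x - m).ofLp)) - 1 / 2 * Real.log S.det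
    - k / 2 * Real.log (2 * Real.pi)

theorem measurable_logDensity (m : E k) (S : Matrix (Fin k) (Fin k) ℝ) :
    Measurable (logDensity m S) := by
  have : Continuous (logDensity m S) := by
    unfold logDensity
    fun_prop
  exact this.measurable

theorem logDensity_zero_one (x : E k) :
    logDensity 0 1 x = -(1 / 2) * ‖x‖ ^ 2 - k / 2 * Real.log (2 * Real.pi) := by
  rw [logDensity, EuclideanSpace.real_norm_sq_eq]
  simp [dotProduct, sq]

theorem exp_logDensity_zero_one (x : E k) : Real.exp (logDensity 0 1 x)
    = (2 * Real.pi) ^ (-(k / 2 : ℝ)) * Real.exp (-(1 / 2) * ‖x‖ ^ 2) := by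
  rw [logDensity_zero_one, Real.rpow_def_of_pos (by positivity), ← Real.exp_add]
  congr 1
  ring

/-- The Fourier transform of the standard density; it identifies that density with `stdGaussian`
through characteristic functions. -/
theorem integral_exp_logDensity_mul (t : E k) :
    ∫ x : E k, (Real.exp (logDensity 0 1 x) : ℂ) * Complex.exp (inner ℝ x t * Complex.I)
      = Complex.exp (-‖t‖ ^ 2 / 2) := by
  have h := GaussianFourier.integral_cexp_neg_mul_sq_norm_add (V := E k) (b := 1 / 2)
    (by norm_num) Complex.I t
  have e : ∀ x : E k, (Real.exp (logDensity 0 1 x) : ℂ) * Complex.exp (inner ℝ x t * Complex.I)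
      = ((2 * Real.pi : ℝ) ^ (-(k / 2 : ℝ)) : ℝ)
        * Complex.exp (-(1 / 2) * ‖x‖ ^ 2 + Complex.I * inner ℝ t x) := fun x => by
    rw [exp_logDensity_zero_one, Complex.ofReal_mul, mul_assoc, Complex.ofReal_exp,
      ← Complex.exp_add, real_inner_comm]
    congr 2
    push_cast
    ring
  simp_rw [e]
  rw [integral_const_mul, h, ← mul_assoc]
  have hpi : ((2 * Real.pi : ℝ) ^ (-(k / 2 : ℝ)) : ℝ) * ((Real.pi / (1 / 2 : ℂ)) ^
      (Module.finrank ℝ (E k) / 2 : ℂ)) = 1 := by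
    have : (Real.pi / (1 / 2 : ℂ)) ^ (Module.finrank ℝ (E k) / 2 : ℂ)
        = (((2 * Real.pi) ^ (k / 2 : ℝ) : ℝ) : ℂ) := by
      rw [Complex.ofReal_cpow (by positivity)]
      simp [finrank_euclideanSpace]
      ring_nf
    rw [this, ← Complex.ofReal_mul, ← Real.rpow_add (by positivity)]
    simp
  rw [hpi, one_mul, Complex.I_sq]
  congr 1
  ring

theorem integrable_exp_logDensity : Integrable (fun x : E k => Real.exp (logDensity 0 1 x)) := by
  simp_rw [exp_logDensity_zero_one]
  refine Integrable.const_mul ?_ _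
  have := (GaussianFourier.integrable_cexp_neg_mul_sq_norm_add (V := E k) (b := 1 / 2)
    (by norm_num) 0 0).norm
  refine this.congr (ae_of_all _ fun x => ?_)
  simp [Complex.norm_exp, ← Complex.ofReal_pow]

theorem stdGaussian_eq_withDensity : stdGaussian (E k)
    = volume.withDensity (fun x => ENNReal.ofReal (Real.exp (logDensity 0 1 x))) := by
  have hm : Measurable (fun x : E k => ENNReal.ofReal (Real.exp (logDensity 0 1 x))) :=
    (measurable_logDensity 0 1).exp.ennreal_ofReal
  have : IsFiniteMeasure (volume.withDensity
      (fun x : E k => ENNReal.ofReal (Real.exp (logDensity 0 1 x)))) :=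
    isFiniteMeasure_withDensity_ofReal integrable_exp_logDensity.2
  apply Measure.ext_of_charFun
  ext t
  rw [charFun_stdGaussian, charFun_apply, integral_withDensity_eq_integral_toReal_smul hm
    (ae_of_all _ fun x => ENNReal.ofReal_lt_top), ← integral_exp_logDensity_mul]
  refine integral_congr_ae (ae_of_all _ fun x => ?_)
  simp [ENNReal.toReal_ofReal (Real.exp_pos _).le]

/-- The density of a nondegenerate Gaussian measure. -/
theorem multivariateGaussian_eq_withDensity (m : E k) {S : Matrix (Fin k) (Fin k) ℝ}
    (hS : S.PosDef) : multivariateGaussian m S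
      = volume.withDensity (fun x => ENNReal.ofReal (Real.exp (logDensity m S x))) := by
  obtain ⟨R, hRt, hRd, hR⟩ := exists_sqrt hS
  have hu : IsUnit R.det := isUnit_iff_ne_zero.2 hRd
  -- `T` carries the standard Gaussian to `𝒩(m, S)` because `R Rᵀ = S`; the density then follows by
  -- change of variables with Jacobian `|det R|`.
  set T : E k → E k := fun x => m + Matrix.toEuclideanLin R x with hT
  have mR : Measurable (Matrix.toEuclideanLin R) :=
    (LinearMap.continuous_of_finiteDimensional (Matrix.toEuclideanLin R)).measurable
  have hTm : Measurable T := mR.const_add m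
  have h1 : multivariateGaussian m S = (stdGaussian (E k)).map T := by
    have := multivariateGaussian_map_affine (0 : E k) PosSemidef.one m R
    rw [multivariateGaussian_zero_one] at this
    simp only [map_zero, add_zero, Matrix.mul_one, hRt, hR] at this
    exact this.symm
  have hdet : S.det = R.det ^ 2 := by rw [← hR, det_mul, sq]
  have hvol : (volume : Measure (E k)).map T = ENNReal.ofReal |(R.det)⁻¹| • volume := by
    have h := Measure.map_linearMap_addHaar_eq_smul_addHaar (volume : Measure (E k))
      (f := Matrix.toEuclideanLin R) (by rwa [LinearMap.det_toLpLin])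
    rw [LinearMap.det_toLpLin] at h
    have e : T = (fun y => m + y) ∘ (Matrix.toEuclideanLin R) := rfl
    rw [e, ← Measure.map_map (by fun_prop) mR, h, Measure.map_smul, map_add_left_eq_self]
  have hlog : ∀ x, logDensity 0 1 x = logDensity m S (T x) + Real.log |R.det| := fun x => by
    have hq : (T x - m).ofLp ⬝ᵥ (S⁻¹ *ᵥ (T x - m).ofLp) = x.ofLp ⬝ᵥ x.ofLp := by
      have e : (T x - m).ofLp = R *ᵥ x.ofLp := by simp [hT, Matrix.toLpLin_apply]
      have e2 : Rᵀ * (S⁻¹ * R) = 1 := by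
        rw [hRt, ← hR, Matrix.mul_inv_rev, Matrix.mul_assoc, nonsing_inv_mul _ hu, Matrix.mul_one,
          mul_nonsing_inv _ hu]
      rw [e, mulVec_mulVec, ← vecMul_transpose, ← dotProduct_mulVec, mulVec_mulVec, e2,
        one_mulVec]
    have e0 : Real.log S.det = 2 * Real.log |R.det| := by
      rw [hdet, Real.log_pow, Real.log_abs]
      norm_num
    rw [logDensity, logDensity, hq, e0]
    simp
    ring
  have hf : Measurable (fun y => ENNReal.ofReal (Real.exp (logDensity m S y + Real.log |R.det|))) :=
    ((measurable_logDensity m S).add_const _).exp.ennreal_ofReal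
  rw [h1, stdGaussian_eq_withDensity]
  have e : (fun x => ENNReal.ofReal (Real.exp (logDensity 0 1 x)))
      = (fun y => ENNReal.ofReal (Real.exp (logDensity m S y + Real.log |R.det|))) ∘ T := by
    funext x
    rw [hlog x]
    rfl
  rw [e, withDensity_comp_map _ hTm hf, hvol, withDensity_smul_measure, ← withDensity_smul _ hf]
  congr 1
  funext y
  simp only [Pi.smul_apply, smul_eq_mul]
  rw [← ENNReal.ofReal_mul (abs_nonneg _), Real.exp_add, Real.exp_log (abs_pos.2 hRd), abs_inv]
  congr 1
  have := abs_pos.2 hRd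
  field_simp

theorem isFiniteMeasure_gaussianMeasure (c : ℝ) (m : E k) (S : Matrix (Fin k) (Fin k) ℝ) :
    IsFiniteMeasure (gaussianMeasure c m S) := by
  rw [gaussianMeasure]
  exact Measure.smul_finite _ ENNReal.ofReal_ne_top

theorem gaussianMeasure_univ (c : ℝ) (m : E k) (S : Matrix (Fin k) (Fin k) ℝ) :
    gaussianMeasure c m S Set.univ = ENNReal.ofReal c := by
  simp [gaussianMeasure]

/-- The log-ratio of two Gaussian measures. -/
noncomputable def logRatio (c : ℝ) (m : E k) (S : Matrix (Fin k) (Fin k) ℝ) (c₀ : ℝ) (m₀ : E k)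
    (S₀ : Matrix (Fin k) (Fin k) ℝ) (x : E k) : ℝ :=
  Real.log (c / c₀) + logDensity m S x - logDensity m₀ S₀ x

theorem measurable_logRatio (c : ℝ) (m : E k) (S : Matrix (Fin k) (Fin k) ℝ) (c₀ : ℝ) (m₀ : E k)
    (S₀ : Matrix (Fin k) (Fin k) ℝ) : Measurable (logRatio c m S c₀ m₀ S₀) :=
  ((measurable_logDensity m S).const_add _).sub (measurable_logDensity m₀ S₀)

/-- One Gaussian is an exponential tilt of the other, the form that both divergence lemmas below
require. -/
theorem gaussianMeasure_eq_withDensity {c c₀ : ℝ} (hc : 0 < c) (hc₀ : 0 < c₀) (m m₀ : E k)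
    {S S₀ : Matrix (Fin k) (Fin k) ℝ} (hS : S.PosDef) (hS₀ : S₀.PosDef) :
    gaussianMeasure c m S = (gaussianMeasure c₀ m₀ S₀).withDensity
      (fun x => ENNReal.ofReal (Real.exp (logRatio c m S c₀ m₀ S₀ x))) := by
  have h1 : Measurable fun x : E k => ENNReal.ofReal (Real.exp (logDensity m S x)) :=
    (measurable_logDensity m S).exp.ennreal_ofReal
  have h0 : Measurable fun x : E k => ENNReal.ofReal (Real.exp (logDensity m₀ S₀ x)) :=
    (measurable_logDensity m₀ S₀).exp.ennreal_ofReal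
  have hr : Measurable fun x : E k => ENNReal.ofReal (Real.exp (logRatio c m S c₀ m₀ S₀ x)) :=
    (measurable_logRatio c m S c₀ m₀ S₀).exp.ennreal_ofReal
  rw [gaussianMeasure, gaussianMeasure, multivariateGaussian_eq_withDensity m hS,
    multivariateGaussian_eq_withDensity m₀ hS₀, withDensity_smul_measure, ← withDensity_mul _ h0 hr,
    ← withDensity_smul _ h1, ← withDensity_smul _ (h0.mul hr)]
  congr 1
  funext x
  simp only [Pi.smul_apply, smul_eq_mul, Pi.mul_apply]
  rw [← ENNReal.ofReal_mul hc.le, ← ENNReal.ofReal_mul (Real.exp_pos _).le,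
    ← ENNReal.ofReal_mul hc₀.le, ← Real.exp_add, logRatio]
  congr 1
  have e : logDensity m₀ S₀ x + (Real.log (c / c₀) + logDensity m S x - logDensity m₀ S₀ x)
      = Real.log (c / c₀) + logDensity m S x := by ring
  rw [e, Real.exp_add, Real.exp_log (by positivity)]
  field_simp

end Gaussian

/-! ### Kullback-Leibler divergence from a Gaussian measure -/

section KL

open Matrix

variable {α : Type*} {mα : MeasurableSpace α}

/-- Change of reference measure in the Kullback-Leibler divergence. -/
theorem integral_add_le_toReal_klDiv {μ ν : Measure α} [IsFiniteMeasure μ] [IsFiniteMeasure ν]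
    {f : α → ℝ} (hf : Measurable f) (hfi : Integrable f μ)
    (hν : IsFiniteMeasure (ν.withDensity fun x => ENNReal.ofReal (Real.exp (f x))))
    (h : klDiv μ ν ≠ ∞) :
    ∫ x, f x ∂μ + ν.real Set.univ
      - (ν.withDensity fun x => ENNReal.ofReal (Real.exp (f x))).real Set.univ
      ≤ (klDiv μ ν).toReal := by
  obtain ⟨hac, hint⟩ := klDiv_ne_top_iff.1 h
  set g : α → ℝ≥0∞ := fun x => ENNReal.ofReal (Real.exp (f x)) with hg
  have hgm : Measurable g := hf.exp.ennreal_ofReal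
  have hg0 : ∀ x, g x ≠ 0 := fun x => by simp [hg, Real.exp_pos]
  have hac' : μ ≪ ν.withDensity g :=
    hac.trans (withDensity_absolutelyContinuous' hgm.aemeasurable (ae_of_all _ hg0))
  have hllr : llr μ (ν.withDensity g) =ᵐ[μ] fun x => llr μ ν x - f x := by
    have h1 := hac.ae_le (Measure.rnDeriv_withDensity_right μ ν hgm.aemeasurable
      (ae_of_all _ hg0) (ae_of_all _ fun x => ENNReal.ofReal_ne_top))
    have h2 := hac.ae_le (Measure.rnDeriv_lt_top μ ν)
    filter_upwards [h1, h2, Measure.rnDeriv_pos hac] with x hx hx2 hx3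
    have hpos := ENNReal.toReal_pos hx3.ne' hx2.ne
    rw [llr, llr, hx, ENNReal.toReal_mul, ENNReal.toReal_inv,
      ENNReal.toReal_ofReal (Real.exp_pos _).le,
      Real.log_mul (inv_ne_zero (Real.exp_pos _).ne') hpos.ne', Real.log_inv, Real.log_exp]
    ring
  have hint' : Integrable (llr μ (ν.withDensity g)) μ := (hint.sub hfi).congr hllr.symm
  -- Gibbs' inequality for `μ` against the tilted measure `e^f ν`.
  have hnn := integral_llr_add_sub_measure_univ_nonneg hac' hint'
  rw [integral_congr_ae hllr, integral_sub hint hfi] at hnn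
  rw [toReal_klDiv hac hint]
  linarith

/-- The equality case of the preceding bound: the log-likelihood ratio of the tilted measure is `f`
itself. -/
theorem klDiv_withDensity_exp {ν : Measure α} [IsFiniteMeasure ν] {f : α → ℝ} (hf : Measurable f)
    (hν : IsFiniteMeasure (ν.withDensity fun x => ENNReal.ofReal (Real.exp (f x))))
    (hfi : Integrable f (ν.withDensity fun x => ENNReal.ofReal (Real.exp (f x)))) :
    klDiv (ν.withDensity fun x => ENNReal.ofReal (Real.exp (f x))) ν ≠ ∞ ∧
    (klDiv (ν.withDensity fun x => ENNReal.ofReal (Real.exp (f x))) ν).toReal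
      = ∫ x, f x ∂(ν.withDensity fun x => ENNReal.ofReal (Real.exp (f x)))
        + ν.real Set.univ
        - (ν.withDensity fun x => ENNReal.ofReal (Real.exp (f x))).real Set.univ := by
  set g : α → ℝ≥0∞ := fun x => ENNReal.ofReal (Real.exp (f x)) with hg
  have hgm : Measurable g := hf.exp.ennreal_ofReal
  have hac : ν.withDensity g ≪ ν := withDensity_absolutelyContinuous ν g
  have hllr : llr (ν.withDensity g) ν =ᵐ[ν.withDensity g] f := by
    filter_upwards [hac.ae_le (Measure.rnDeriv_withDensity ν hgm)] with x hx
    rw [llr, hx, ENNReal.toReal_ofReal (Real.exp_pos _).le, Real.log_exp]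
  have hint := hfi.congr hllr.symm
  refine ⟨klDiv_ne_top hac hint, ?_⟩
  rw [toReal_klDiv hac hint, integral_congr_ae hllr]

variable {k : ℕ}

/-- The relative entropy of `𝒩(m, S)` with respect to `𝒩(m₀, S₀)`. -/
noncomputable def gaussianKL (m : E k) (S : Matrix (Fin k) (Fin k) ℝ) (m₀ : E k)
    (S₀ : Matrix (Fin k) (Fin k) ℝ) : ℝ :=
  1 / 2 * ((S₀⁻¹ * S).trace + (m - m₀).ofLp ⬝ᵥ (S₀⁻¹ *ᵥ (m - m₀).ofLp) + Real.log S₀.det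
    - Real.log S.det - k)

theorem integral_logDensity {P : Measure (E k)} [IsProbabilityMeasure P] (hP : MemLp id 2 P)
    (m : E k) (S : Matrix (Fin k) (Fin k) ℝ) :
    Integrable (logDensity m S) P ∧ ∫ x, logDensity m S x ∂P
      = -(1 / 2) * ((S⁻¹ * covOf P).trace + (meanOf P - m).ofLp ⬝ᵥ (S⁻¹ *ᵥ (meanOf P - m).ofLp))
        - 1 / 2 * Real.log S.det - k / 2 * Real.log (2 * Real.pi) := by
  obtain ⟨h1, h2⟩ := integral_quad hP S⁻¹ m
  unfold logDensity
  have h3 := h1.const_mul (-(1 / 2) : ℝ)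
  have h4 : Integrable (fun x : E k => -(1 / 2) * ((x - m).ofLp ⬝ᵥ (S⁻¹ *ᵥ (x - m).ofLp))
    - 1 / 2 * Real.log S.det) P := h3.sub (integrable_const _)
  refine ⟨h4.sub (integrable_const _), ?_⟩
  rw [integral_sub h4 (integrable_const _), integral_sub h3 (integrable_const _), integral_const_mul, h2]
  simp

/-- The log-ratio is a quadratic polynomial, so its integral under `P` depends only on the moments
of `P`. It is the same as under the Gaussian with these moments. -/
theorem integral_logRatio {P : Measure (E k)} [IsProbabilityMeasure P] (hP : MemLp id 2 P)
    (hC : (covOf P).PosDef) (c c₀ : ℝ) (m₀ : E k) (S₀ : Matrix (Fin k) (Fin k) ℝ) :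
    Integrable (logRatio c (meanOf P) (covOf P) c₀ m₀ S₀) P ∧
      ∫ x, logRatio c (meanOf P) (covOf P) c₀ m₀ S₀ x ∂P
        = Real.log (c / c₀) + gaussianKL (meanOf P) (covOf P) m₀ S₀ := by
  obtain ⟨h1, h2⟩ := integral_logDensity hP (meanOf P) (covOf P)
  obtain ⟨h3, h4⟩ := integral_logDensity hP m₀ S₀
  have hi : Integrable (fun x => Real.log (c / c₀) + logDensity (meanOf P) (covOf P) x) P :=
    (integrable_const _).add h1
  unfold logRatio
  refine ⟨hi.sub h3, ?_⟩
  rw [integral_sub hi h3, integral_add (integrable_const _) h1, h2, h4,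
    nonsing_inv_mul _ (isUnit_iff_ne_zero.2 hC.det_pos.ne')]
  simp [gaussianKL]
  ring

theorem real_univ_gaussianMeasure {c : ℝ} (hc : 0 ≤ c) (m : E k)
    (S : Matrix (Fin k) (Fin k) ℝ) : (gaussianMeasure c m S).real Set.univ = c := by
  rw [measureReal_def, gaussianMeasure_univ, ENNReal.toReal_ofReal hc]

/-- Among measures of given mass, mean and covariance, the Gaussian one minimizes the divergence. -/
theorem gaussianKL_le_toReal_klDiv {P : Measure (E k)} [IsProbabilityMeasure P]
    (hP : MemLp id 2 P) (hC : (covOf P).PosDef) {c c₀ : ℝ} (hc : 0 < c) (hc₀ : 0 < c₀) (m₀ : E k)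
    {S₀ : Matrix (Fin k) (Fin k) ℝ} (hS₀ : S₀.PosDef)
    (h : klDiv (ENNReal.ofReal c • P) (gaussianMeasure c₀ m₀ S₀) ≠ ∞) :
    c * (Real.log (c / c₀) + gaussianKL (meanOf P) (covOf P) m₀ S₀) + c₀ - c
      ≤ (klDiv (ENNReal.ofReal c • P) (gaussianMeasure c₀ m₀ S₀)).toReal := by
  obtain ⟨h1, h2⟩ := integral_logRatio hP hC c c₀ m₀ S₀
  have e := gaussianMeasure_eq_withDensity hc hc₀ (meanOf P) m₀ hC hS₀
  have f1 := isFiniteMeasure_gaussianMeasure c (meanOf P) (covOf P)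
  have f2 := isFiniteMeasure_gaussianMeasure c₀ m₀ S₀
  have f3 : IsFiniteMeasure (ENNReal.ofReal c • P) := Measure.smul_finite _ ENNReal.ofReal_ne_top
  -- The tilt is chosen so that the tilted reference is the Gaussian with the mass, mean and
  -- covariance of `c • P`.
  have key := integral_add_le_toReal_klDiv (measurable_logRatio c (meanOf P) (covOf P) c₀ m₀ S₀)
    (h1.smul_measure ENNReal.ofReal_ne_top) (e ▸ f1) h
  rw [← e, real_univ_gaussianMeasure hc.le, real_univ_gaussianMeasure hc₀.le,
    integral_smul_measure, h2, ENNReal.toReal_ofReal hc.le, smul_eq_mul] at key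
  exact key

/-- Equality in the Gaussian lower bound, attained when the measure is itself Gaussian. -/
theorem klDiv_gaussianMeasure {c c₀ : ℝ} (hc : 0 < c) (hc₀ : 0 < c₀) (m m₀ : E k)
    {S S₀ : Matrix (Fin k) (Fin k) ℝ} (hS : S.PosDef) (hS₀ : S₀.PosDef) :
    klDiv (gaussianMeasure c m S) (gaussianMeasure c₀ m₀ S₀) ≠ ∞ ∧
    (klDiv (gaussianMeasure c m S) (gaussianMeasure c₀ m₀ S₀)).toReal
      = c * (Real.log (c / c₀) + gaussianKL m S m₀ S₀) + c₀ - c := by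
  have e := gaussianMeasure_eq_withDensity hc hc₀ m m₀ hS hS₀
  have f1 := isFiniteMeasure_gaussianMeasure c m S
  have f2 := isFiniteMeasure_gaussianMeasure c₀ m₀ S₀
  have hm := meanOf_multivariateGaussian m S
  have hcov := covOf_multivariateGaussian m hS.posSemidef
  obtain ⟨h1, h2⟩ := integral_logRatio (memLp_id_multivariateGaussian m S) (hcov.symm ▸ hS) c c₀
    m₀ S₀
  rw [hm, hcov] at h1 h2
  have h1' : Integrable (logRatio c m S c₀ m₀ S₀) (gaussianMeasure c m S) :=
    h1.smul_measure ENNReal.ofReal_ne_top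
  have key := klDiv_withDensity_exp (measurable_logRatio c m S c₀ m₀ S₀) (e ▸ f1) (e ▸ h1')
  rw [← e, real_univ_gaussianMeasure hc.le, real_univ_gaussianMeasure hc₀.le] at key
  refine ⟨key.1, ?_⟩
  rw [key.2, gaussianMeasure, integral_smul_measure, h2, ENNReal.toReal_ofReal hc.le, smul_eq_mul]

/-- A law with singular covariance is concentrated on a hyperplane. -/
theorem covOf_posDef_of_absolutelyContinuous {P : Measure (E k)} [IsProbabilityMeasure P]
    (hP : MemLp id 2 P) (hac : P ≪ volume) : (covOf P).PosDef := by
  have hpsd := covOf_posSemidef hP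
  rw [hpsd.posDef_iff_det_ne_zero]
  intro hdet
  -- For `w` in the kernel of the covariance, `w ⬝ᵥ x` has variance zero, so `P` lives on a
  -- hyperplane, which is Lebesgue-null.
  obtain ⟨w, hw0, hw⟩ := exists_mulVec_eq_zero_iff.2 hdet
  have hint : Integrable (fun x : E k => (x - meanOf P).ofLp ⬝ᵥ
      (vecMulVec w w *ᵥ (x - meanOf P).ofLp)) P := (integral_quad hP _ _).1
  have hz := (integral_quad hP (vecMulVec w w) (meanOf P)).2
  have hsq : ∀ y : Fin k → ℝ, y ⬝ᵥ (vecMulVec w w *ᵥ y) = (w ⬝ᵥ y) ^ 2 := fun y => by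
    rw [vecMulVec_mulVec, dotProduct_smul, dotProduct_comm y w]
    simp [sq]
  have htr : (vecMulVec w w * covOf P).trace = 0 := by
    rw [trace_mul_comm, trace_mul_vecMulVec, hw, dotProduct_zero]
  simp only [hsq] at hz hint
  rw [htr, sub_self, WithLp.ofLp_zero, dotProduct_zero, zero_pow two_ne_zero, add_zero, integral_eq_zero_iff_of_nonneg
    (fun x => sq_nonneg _) hint] at hz
  · set φ : E k →L[ℝ] ℝ := innerSL ℝ (WithLp.toLp 2 w) with hφ
    have hφ' : ∀ y : E k, φ y = w ⬝ᵥ y.ofLp := fun y => by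
      simp [hφ, EuclideanSpace.inner_eq_star_dotProduct, dotProduct_comm]
    set s : AffineSubspace ℝ (E k) := AffineSubspace.mk' (meanOf P) (LinearMap.ker φ.toLinearMap)
      with hs
    have hs0 : (volume : Measure (E k)) s = 0 := by
      refine Measure.addHaar_affineSubspace _ s fun htop => hw0 ?_
      have hd : s.direction = ⊤ := by rw [htop, AffineSubspace.direction_top]
      rw [hs, AffineSubspace.direction_mk'] at hd
      have hmem : (WithLp.toLp 2 w : E k) ∈ LinearMap.ker φ.toLinearMap := hd ▸ Submodule.mem_top
      have h0 : φ (WithLp.toLp 2 w) = 0 := hmem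
      rw [hφ'] at h0
      exact dotProduct_self_eq_zero.1 h0
    have h1 : ∀ᵐ x ∂P, x ∈ (s : Set (E k)) := by
      filter_upwards [hz] with x hx
      have h0 : w ⬝ᵥ (x - meanOf P).ofLp = 0 := by simpa using hx
      have : φ (x - meanOf P) = 0 := by rw [hφ', h0]
      exact (AffineSubspace.mem_mk').2 this
    have h2 : P (s : Set (E k)) = 0 := hac hs0
    have h3 : P (s : Set (E k))ᶜ = 0 := h1
    have h4 := measure_union_le (μ := P) (s : Set (E k)) (s : Set (E k))ᶜ
    rw [Set.union_compl_self, measure_univ, h2, h3] at h4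
    simp at h4

/-- Finite divergence from a nondegenerate Gaussian gives absolute continuity with respect to
Lebesgue measure. -/
theorem covOf_posDef_of_klDiv_ne_top {P : Measure (E k)} [IsProbabilityMeasure P]
    (hP : MemLp id 2 P) {c c₀ : ℝ} (hc : 0 < c) (m₀ : E k)
    {S₀ : Matrix (Fin k) (Fin k) ℝ} (hS₀ : S₀.PosDef)
    (h : klDiv (ENNReal.ofReal c • P) (gaussianMeasure c₀ m₀ S₀) ≠ ∞) : (covOf P).PosDef := by
  refine covOf_posDef_of_absolutelyContinuous hP ?_
  have h1 := (klDiv_ne_top_iff.1 h).1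
  have h2 : gaussianMeasure c₀ m₀ S₀ ≪ volume := by
    rw [gaussianMeasure, multivariateGaussian_eq_withDensity m₀ hS₀]
    exact (withDensity_absolutelyContinuous _ _).smul_left _
  have hc' : ENNReal.ofReal c ≠ 0 := by simpa using hc
  exact (Measure.absolutelyContinuous_smul hc').trans (h1.trans h2)

end KL

/-! ### Affine-Gaussian policies -/

section Policy

open Matrix

variable {d d' N : ℕ}

theorem measurable_toEuclideanLin {k l : ℕ} (C : Matrix (Fin l) (Fin k) ℝ) :
    Measurable (Matrix.toEuclideanLin C) :=
  (LinearMap.continuous_of_finiteDimensional _).measurable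

theorem affineGaussianPolicy_apply (m : E d) (v : E d') (K : Matrix (Fin d') (Fin d) ℝ)
    {W : Matrix (Fin d') (Fin d') ℝ} (hW : W.PosSemidef) (x : E d) :
    affineGaussianPolicy m v K W x = (multivariateGaussian 0 W).map
      (fun w => v + Matrix.toEuclideanLin K (x - m) + w) := by
  have h := multivariateGaussian_map_affine (0 : E d') hW (v + Matrix.toEuclideanLin K (x - m)) 1
  have e : ∀ w : E d', Matrix.toEuclideanLin (1 : Matrix (Fin d') (Fin d') ℝ) w = w := fun w => by
    simp
  simp only [e, add_zero, Matrix.one_mul, transpose_one, Matrix.mul_one] at h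
  exact h.symm

instance isMarkovKernel_affineGaussianPolicy (m : E d) (v : E d')
    (K : Matrix (Fin d') (Fin d) ℝ) (W : Matrix (Fin d') (Fin d') ℝ) :
    IsMarkovKernel (affineGaussianPolicy m v K W) :=
  ⟨fun x => by
    change IsProbabilityMeasure (multivariateGaussian (v + Matrix.toEuclideanLin K (x - m)) W)
    infer_instance⟩

/-- The control is an affine function of the state plus independent noise. Laws under the policy
thus become images of a product measure under affine maps. -/
theorem compProd_affineGaussianPolicy (P : Measure (E d)) [IsProbabilityMeasure P] (m : E d)
    (v : E d') (K : Matrix (Fin d') (Fin d) ℝ) {W : Matrix (Fin d') (Fin d') ℝ}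
    (hW : W.PosSemidef) : P ⊗ₘ affineGaussianPolicy m v K W
      = (P.prod (multivariateGaussian 0 W)).map
        (fun p => (p.1, v + Matrix.toEuclideanLin K (p.1 - m) + p.2)) := by
  have hT : Measurable (fun p : E d × E d' =>
      (p.1, v + Matrix.toEuclideanLin K (p.1 - m) + p.2)) :=
    measurable_fst.prodMk ((((measurable_toEuclideanLin K).comp
      (measurable_fst.sub_const m)).const_add v).add measurable_snd)
  ext s hs
  rw [Measure.compProd_apply hs, Measure.map_apply hT hs, Measure.prod_apply (hT hs)]
  refine lintegral_congr fun x => ?_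
  rw [affineGaussianPolicy_apply m v K hW, Measure.map_apply (by fun_prop)
    (measurable_prodMk_left hs)]
  rfl

variable {m : E d} {C : Matrix (Fin d) (Fin d) ℝ} {v : E d'} {K : Matrix (Fin d') (Fin d) ℝ}
  {W : Matrix (Fin d') (Fin d') ℝ}

theorem snd_compProd_affineGaussianPolicy (hC : C.PosSemidef) (hW : W.PosSemidef) :
    (multivariateGaussian m C ⊗ₘ affineGaussianPolicy m v K W).snd
      = multivariateGaussian v (K * C * Kᵀ + W) := by
  have hT : Measurable (fun p : E d × E d' =>
      (p.1, v + Matrix.toEuclideanLin K (p.1 - m) + p.2)) :=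
    measurable_fst.prodMk ((((measurable_toEuclideanLin K).comp
      (measurable_fst.sub_const m)).const_add v).add measurable_snd)
  rw [compProd_affineGaussianPolicy _ m v K hW, Measure.snd, Measure.map_map measurable_snd hT]
  have h := gaussian_prod_map_affine m hC hW (v - Matrix.toEuclideanLin K m) K 1
  rw [sub_add_cancel, Matrix.one_mul, transpose_one, Matrix.mul_one] at h
  rw [← h]
  congr 1
  funext p
  simp [Matrix.toLpLin_apply, mulVec_sub]
  abel

/-- The closed loop is `x ↦ (A + B K) x + B (v - K m) + B w` with independent `w ∼ 𝒩(0, W)`; the `K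
m` terms cancel in the mean. -/
theorem Data.map_step_compProd_affineGaussianPolicy (D : Data d d' N) (hC : C.PosSemidef)
    (hW : W.PosSemidef) :
    (multivariateGaussian m C ⊗ₘ affineGaussianPolicy m v K W).map D.step
      = multivariateGaussian (Matrix.toEuclideanLin D.A m + Matrix.toEuclideanLin D.B v)
        ((D.A + D.B * K) * C * (D.A + D.B * K)ᵀ + D.B * W * D.Bᵀ) := by
  have hT : Measurable (fun p : E d × E d' =>
      (p.1, v + Matrix.toEuclideanLin K (p.1 - m) + p.2)) :=
    measurable_fst.prodMk ((((measurable_toEuclideanLin K).comp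
      (measurable_fst.sub_const m)).const_add v).add measurable_snd)
  rw [compProd_affineGaussianPolicy _ m v K hW, Measure.map_map D.measurable_step hT]
  have h := gaussian_prod_map_affine m hC hW
    (Matrix.toEuclideanLin D.B v - Matrix.toEuclideanLin (D.B * K) m) (D.A + D.B * K) D.B
  have e : Matrix.toEuclideanLin D.B v - Matrix.toEuclideanLin (D.B * K) m
      + Matrix.toEuclideanLin (D.A + D.B * K) m
      = Matrix.toEuclideanLin D.A m + Matrix.toEuclideanLin D.B v := by
    rw [map_add, LinearMap.add_apply]
    abel
  rw [e] at h
  rw [← h]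
  congr 1
  funext p
  ext i
  simp [Data.step, Matrix.toLpLin_apply, mulVec_sub, mulVec_add, mulVec_mulVec]
  ring

/-- The policy recovered from a feasible point of the SDP. -/
noncomputable def SDPVar.policy (z : SDPVar d d' N) (K : Fin N → Matrix (Fin d') (Fin d) ℝ)
    (W : Fin N → Matrix (Fin d') (Fin d') ℝ) : Fin N → Kernel (E d) (E d') :=
  fun t => affineGaussianPolicy (z.m t.castSucc) (z.v t) (K t) (W t)

variable {D : Data d d' N} {z : SDPVar d d' N} {K : Fin N → Matrix (Fin d') (Fin d) ℝ}
  {W : Fin N → Matrix (Fin d') (Fin d') ℝ}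

theorem SDPVar.isMarkovKernel_policy (t : Fin N) : IsMarkovKernel (z.policy K W t) :=
  isMarkovKernel_affineGaussianPolicy _ _ _ _

/-- Under the recovered policy the state is Gaussian with the moments of the SDP. -/
theorem SDPVar.Recovers.stateMeasure_eq (hz : D.SDPFeasible z) (hr : z.Recovers K W)
    (t : Fin (N + 1)) :
    D.stateMeasure (multivariateGaussian (z.m 0) (z.cov 0)) (z.policy K W) t
      = multivariateGaussian (z.m t) (z.cov t) := by
  induction t using Fin.induction with
  | zero => rfl
  | succ t ih =>
    rw [D.stateMeasure_succ, ih, SDPVar.policy,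
      D.map_step_compProd_affineGaussianPolicy (hz.cov _) (hr.psd t), ← hz.mean t]
    congr 1
    -- By symmetry of `Σ t`. Expanding `(A + B K) Σ (A + B K)ᵀ + B W Bᵀ` then gives the covariance
    -- recursion of the SDP.
    have hs : (z.S t)ᵀ = z.cov t.castSucc * (K t)ᵀ := by
      rw [hr.gain t, transpose_mul, (hz.cov _).transpose_eq]
    rw [hz.covDyn t, hs, hr.gain t, hr.noise t]
    simp only [transpose_add, transpose_mul, Matrix.add_mul, Matrix.mul_add, Matrix.mul_assoc]
    abel

theorem SDPVar.Recovers.lintegral_control_eq (hz : D.SDPFeasible z) (hr : z.Recovers K W)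
    (t : Fin N) :
    ∫⁻ x, ∫⁻ u, ‖u‖ₑ ^ 2 ∂(z.policy K W t x)
      ∂(D.stateMeasure (multivariateGaussian (z.m 0) (z.cov 0)) (z.policy K W) t.castSucc)
      = ENNReal.ofReal (‖z.v t‖ ^ 2 + (z.Y t).trace) := by
  have := SDPVar.isMarkovKernel_policy (z := z) (K := K) (W := W) t
  have hY : (z.Y t).PosSemidef := (hz.lmi t).submatrix Sum.inl
  rw [hr.stateMeasure_eq hz, lintegral_control, SDPVar.policy,
    snd_compProd_affineGaussianPolicy (hz.cov _) (hr.psd t), ← hr.noise t,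
    lintegral_enorm_sq (memLp_id_multivariateGaussian _ _), meanOf_multivariateGaussian,
    covOf_multivariateGaussian _ hY]

theorem SDPVar.Recovers.controlEnergy_eq (hz : D.SDPFeasible z) (hr : z.Recovers K W) :
    D.controlEnergy (multivariateGaussian (z.m 0) (z.cov 0)) (z.policy K W)
      = ENNReal.ofReal (∑ t, (‖z.v t‖ ^ 2 + (z.Y t).trace)) := by
  rw [Data.controlEnergy, ENNReal.ofReal_sum_of_nonneg fun t _ =>
    add_nonneg (sq_nonneg _) (SDPVar.trace_Y_nonneg hz t)]
  exact Finset.sum_congr rfl fun t _ => hr.lintegral_control_eq hz t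

theorem memM2_multivariateGaussian {k : ℕ} (m : E k) (S : Matrix (Fin k) (Fin k) ℝ) :
    MemM2 (multivariateGaussian m S) :=
  ⟨inferInstance, by
    rw [lintegral_enorm_sq (memLp_id_multivariateGaussian m S)]
    exact ENNReal.ofReal_lt_top⟩

theorem memM2_smul_iff {k : ℕ} {μ : Measure (E k)} [IsFiniteMeasure μ] {c : ℝ} (hc : 0 < c) :
    MemM2 (ENNReal.ofReal c • μ) ↔ MemM2 μ := by
  have h : IsFiniteMeasure (ENNReal.ofReal c • μ) := Measure.smul_finite _ ENNReal.ofReal_ne_top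
  have hc' : ENNReal.ofReal c ≠ 0 := by simpa using hc
  simp only [MemM2, h, ‹IsFiniteMeasure μ›, true_and, lintegral_smul_measure, smul_eq_mul,
    ENNReal.mul_lt_top_iff]
  simp [hc']
  aesop

theorem Data.admissible_smul_iff (D : Data d d' N) {P : Measure (E d)} [IsFiniteMeasure P]
    {U : Fin N → Kernel (E d) (E d')} {c : ℝ} (hc : 0 < c) :
    D.Admissible (ENNReal.ofReal c • P) U ↔ D.Admissible P U := by
  have hc' : ENNReal.ofReal c ≠ 0 := by simpa using hc
  have key : (∀ t, IsMarkovKernel (U t)) → ((∀ t, MemM2 (D.stateMeasure (ENNReal.ofReal c • P) U t))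
      ↔ ∀ t, MemM2 (D.stateMeasure P U t)) := fun hU => forall_congr' fun t => by
    have := D.isFiniteMeasure_stateMeasure P U hU t
    rw [D.stateMeasure_smul _ P U hU, memM2_smul_iff hc]
  have key2 : (∀ t, IsMarkovKernel (U t)) → (D.controlEnergy (ENNReal.ofReal c • P) U < ∞
      ↔ D.controlEnergy P U < ∞) := fun hU => by
    rw [D.controlEnergy_smul _ P U hU]
    refine ⟨fun h => ?_, fun h => ENNReal.mul_lt_top ENNReal.ofReal_lt_top h⟩
    exact ENNReal.lt_top_of_mul_ne_top_right h.ne hc'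
  exact ⟨fun h => ⟨h.markov, (key h.markov).1 h.memM2, (key2 h.markov).1 h.energy⟩,
    fun h => ⟨h.markov, (key h.markov).2 h.memM2, (key2 h.markov).2 h.energy⟩⟩

end Policy

/-! ### The value of the control problem -/

section Value

open Matrix

variable {d d' N : ℕ}

/-- The optimal cost among pairs of mass `c`, in terms of the value `p` of the SDP. -/
noncomputable def Data.massCost (D : Data d d' N) (p c : ℝ) : ℝ :=
  c * (p + D.γ * D.L / 2) + D.γ * (c * Real.log (c / D.cα) + D.cα - c)
    + D.γ * (c * Real.log (c / D.cβ) + D.cβ - c)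

theorem Data.massUpdate_pos (D : Data d d' N) (hD : D.Valid) (p : ℝ) : 0 < D.massUpdate p :=
  mul_pos (Real.sqrt_pos.2 (mul_pos hD.cα_pos hD.cβ_pos)) (Real.exp_pos _)

/-- The logarithm of `massUpdate p` is exactly what collects the terms linear in `c`; this is where
the closed formula for the mass comes from. -/
theorem Data.massCost_eq (D : Data d d' N) (hD : D.Valid) (p : ℝ) {c : ℝ} (hc : 0 < c) :
    D.massCost p c = D.γ * (D.cα + D.cβ)
      + 2 * D.γ * (c * (Real.log c - Real.log (D.massUpdate p)) - c) := by
  have hα := hD.cα_pos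
  have hβ := hD.cβ_pos
  have hγ := hD.γ_pos.ne'
  have hlog : Real.log (D.massUpdate p)
      = (Real.log D.cα + Real.log D.cβ) / 2 + (-p / (2 * D.γ) - D.L / 4) := by
    rw [Data.massUpdate, Real.log_mul (Real.sqrt_pos.2 (mul_pos hα hβ)).ne' (Real.exp_pos _).ne',
      Real.log_exp, Real.log_sqrt (mul_pos hα hβ).le, Real.log_mul hα.ne' hβ.ne']
  rw [Data.massCost, hlog, Real.log_div hc.ne' hα.ne', Real.log_div hc.ne' hβ.ne']
  field_simp
  ring

theorem Data.massCost_massUpdate (D : Data d d' N) (hD : D.Valid) (p : ℝ) :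
    D.massCost p (D.massUpdate p) = D.γ * (D.cα + D.cβ) - 2 * D.γ * D.massUpdate p := by
  rw [D.massCost_eq hD p (D.massUpdate_pos hD p)]
  ring

/-- The strict inequality `log x < x - 1` at `x = c⋆ / c ≠ 1`, multiplied by `c`. -/
theorem Data.massCost_massUpdate_lt (D : Data d d' N) (hD : D.Valid) (p : ℝ) {c : ℝ} (hc : 0 < c)
    (hne : c ≠ D.massUpdate p) : D.massCost p (D.massUpdate p) < D.massCost p c := by
  have hs := D.massUpdate_pos hD p
  rw [D.massCost_massUpdate hD, D.massCost_eq hD p hc]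
  have h := Real.log_lt_sub_one_of_pos (div_pos hs hc)
    (fun h => hne ((div_eq_one_iff_eq hc.ne').1 h).symm)
  rw [Real.log_div hs.ne' hc.ne'] at h
  have h2 := mul_lt_mul_of_pos_left h hc
  have e : c * (D.massUpdate p / c - 1) = D.massUpdate p - c := by field_simp
  rw [e] at h2
  nlinarith [hD.γ_pos]

/-- The SDP objective drops the constants of the two Gaussian divergences; `γ L / 2` restores them.
-/
theorem Data.sdpReal_add (D : Data d d' N) (z : SDPVar d d' N) :
    D.sdpReal z + D.γ * D.L / 2 = ∑ t : Fin N, (‖z.v t‖ ^ 2 + (z.Y t).trace)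
      + D.γ * gaussianKL (z.m 0) (z.cov 0) D.mα D.covα
      + D.γ * gaussianKL (z.m (Fin.last N)) (z.cov (Fin.last N)) D.mβ D.covβ := by
  unfold Data.sdpReal Data.M Data.covTerm Data.L gaussianKL
  ring

theorem Data.toReal_J (D : Data d d' N) (hD : D.Valid) {π₁ : Measure (E d)}
    {U : Fin N → Kernel (E d) (E d')} (hE : D.controlEnergy π₁ U ≠ ∞)
    (hα : klDiv π₁ D.α ≠ ∞) (hβ : klDiv (D.stateMeasure π₁ U (Fin.last N)) D.β ≠ ∞) :
    D.J π₁ U ≠ ∞ ∧ (D.J π₁ U).toReal = (D.controlEnergy π₁ U).toReal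
      + D.γ * (klDiv π₁ D.α).toReal
      + D.γ * (klDiv (D.stateMeasure π₁ U (Fin.last N)) D.β).toReal := by
  have h1 := ENNReal.mul_ne_top (ENNReal.ofReal_ne_top (r := D.γ)) hα
  have h2 := ENNReal.mul_ne_top (ENNReal.ofReal_ne_top (r := D.γ)) hβ
  unfold Data.J
  refine ⟨ENNReal.add_ne_top.2 ⟨ENNReal.add_ne_top.2 ⟨hE, h1⟩, h2⟩, ?_⟩
  rw [ENNReal.toReal_add (ENNReal.add_ne_top.2 ⟨hE, h1⟩) h2, ENNReal.toReal_add hE h1,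
    ENNReal.toReal_mul, ENNReal.toReal_mul, ENNReal.toReal_ofReal hD.γ_pos.le]

theorem Data.J_ne_top_iff (D : Data d d' N) (hD : D.Valid) {π₁ : Measure (E d)}
    {U : Fin N → Kernel (E d) (E d')} : D.J π₁ U ≠ ∞ ↔ D.controlEnergy π₁ U ≠ ∞ ∧
      klDiv π₁ D.α ≠ ∞ ∧ klDiv (D.stateMeasure π₁ U (Fin.last N)) D.β ≠ ∞ := by
  have hγ : ENNReal.ofReal D.γ ≠ 0 := by simpa using hD.γ_pos
  refine ⟨fun h => ?_, fun h => (D.toReal_J hD h.1 h.2.1 h.2.2).1⟩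
  unfold Data.J at h
  obtain ⟨h1, h2⟩ := ENNReal.add_ne_top.1 h
  obtain ⟨h1, h3⟩ := ENNReal.add_ne_top.1 h1
  exact ⟨h1, (ENNReal.lt_top_of_mul_ne_top_right h3 hγ).ne,
    (ENNReal.lt_top_of_mul_ne_top_right h2 hγ).ne⟩

variable {D : Data d d' N} {p : ℝ}

/-- The recovered Gaussian pair, of any mass `c > 0`, is admissible, and its cost is explicit. -/
theorem SDPVar.Recovers.toReal_J_eq (hD : D.Valid) {z : SDPVar d d' N}
    {K : Fin N → Matrix (Fin d') (Fin d) ℝ} {W : Fin N → Matrix (Fin d') (Fin d') ℝ}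
    (hz : D.SDPFeasible z) (h0 : (z.cov 0).PosDef) (hT : (z.cov (Fin.last N)).PosDef)
    (hr : z.Recovers K W) {c : ℝ} (hc : 0 < c) :
    D.Admissible (gaussianMeasure c (z.m 0) (z.cov 0)) (z.policy K W) ∧
      D.J (gaussianMeasure c (z.m 0) (z.cov 0)) (z.policy K W) ≠ ∞ ∧
      (D.J (gaussianMeasure c (z.m 0) (z.cov 0)) (z.policy K W)).toReal
        = D.massCost (D.sdpReal z) c := by
  have hU : ∀ t, IsMarkovKernel (z.policy K W t) := SDPVar.isMarkovKernel_policy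
  have hadm : D.Admissible (multivariateGaussian (z.m 0) (z.cov 0)) (z.policy K W) :=
    ⟨hU, fun t => by
      rw [hr.stateMeasure_eq hz]
      exact memM2_multivariateGaussian _ _, by
      rw [hr.controlEnergy_eq hz]
      exact ENNReal.ofReal_lt_top⟩
  have hlast : D.stateMeasure (gaussianMeasure c (z.m 0) (z.cov 0)) (z.policy K W) (Fin.last N)
      = gaussianMeasure c (z.m (Fin.last N)) (z.cov (Fin.last N)) := by
    rw [gaussianMeasure, D.stateMeasure_smul _ _ _ hU, hr.stateMeasure_eq hz, gaussianMeasure]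
  have hE : D.controlEnergy (gaussianMeasure c (z.m 0) (z.cov 0)) (z.policy K W)
      = ENNReal.ofReal c * ENNReal.ofReal (∑ t, (‖z.v t‖ ^ 2 + (z.Y t).trace)) := by
    rw [gaussianMeasure, D.controlEnergy_smul _ _ _ hU, hr.controlEnergy_eq hz]
  obtain ⟨a1, a2⟩ := klDiv_gaussianMeasure hc hD.cα_pos (z.m 0) D.mα h0 hD.covα_pos
  obtain ⟨b1, b2⟩ := klDiv_gaussianMeasure hc hD.cβ_pos (z.m (Fin.last N)) D.mβ hT hD.covβ_pos
  have hJ := D.toReal_J hD (π₁ := gaussianMeasure c (z.m 0) (z.cov 0)) (U := z.policy K W)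
    (hE ▸ ENNReal.mul_ne_top ENNReal.ofReal_ne_top ENNReal.ofReal_ne_top) a1 (hlast ▸ b1)
  refine ⟨(D.admissible_smul_iff hc).2 hadm, hJ.1, ?_⟩
  have hs : 0 ≤ ∑ t, (‖z.v t‖ ^ 2 + (z.Y t).trace) := Finset.sum_nonneg fun t _ =>
    add_nonneg (sq_nonneg _) (SDPVar.trace_Y_nonneg hz t)
  rw [hJ.2, hlast, hE, ENNReal.toReal_mul, ENNReal.toReal_ofReal hc.le, ENNReal.toReal_ofReal hs,
    Data.α, Data.β, a2, b2, Data.massCost, D.sdpReal_add]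
  ring

/-- Lower bound on the cost of an admissible pair of mass `c > 0`. -/
theorem Data.massCost_le_toReal_J (hD : D.Valid)
    (hp : ∀ z, D.SDPFeasible z → (z.cov 0).PosDef → (z.cov (Fin.last N)).PosDef →
      p ≤ D.sdpReal z) {P : Measure (E d)} [IsProbabilityMeasure P]
    {U : Fin N → Kernel (E d) (E d')} {c : ℝ} (hc : 0 < c)
    (h : D.Admissible (ENNReal.ofReal c • P) U) (hJ : D.J (ENNReal.ofReal c • P) U ≠ ∞) :
    D.massCost p c ≤ (D.J (ENNReal.ofReal c • P) U).toReal := by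
  have hP : D.Admissible P U := (D.admissible_smul_iff hc).1 h
  have hpr := D.isProbabilityMeasure_stateMeasure P U hP.markov
  obtain ⟨h1, h2, h3⟩ := (D.J_ne_top_iff hD).1 hJ
  have hlast := D.stateMeasure_smul (ENNReal.ofReal c) P U hP.markov (Fin.last N)
  have hE := D.controlEnergy_smul (ENNReal.ofReal c) P U hP.markov
  rw [(D.toReal_J hD h1 h2 h3).2, hlast, hE, hP.controlEnergy_eq]
  rw [hlast] at h3
  have m0 : MemLp id 2 P := (hP.memM2 0).memLp_id
  have mT := (hP.memM2 (Fin.last N)).memLp_id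
  have c0 := covOf_posDef_of_klDiv_ne_top m0 hc D.mα hD.covα_pos h2
  have cT := covOf_posDef_of_klDiv_ne_top mT hc D.mβ hD.covβ_pos h3
  have k0 := gaussianKL_le_toReal_klDiv m0 c0 hc hD.cα_pos D.mα hD.covα_pos h2
  have kT := gaussianKL_le_toReal_klDiv mT cT hc hD.cβ_pos D.mβ hD.covβ_pos h3
  -- The moments of the normalized pair compete in the SDP, so their objective is at least `p`.
  have hle := hp (D.moments P U) hP.feasible_moments c0 cT
  have hs : 0 ≤ ∑ t, (‖(D.moments P U).v t‖ ^ 2 + ((D.moments P U).Y t).trace) :=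
    Finset.sum_nonneg fun t _ =>
      add_nonneg (sq_nonneg _) (SDPVar.trace_Y_nonneg hP.feasible_moments t)
  have hadd := D.sdpReal_add (D.moments P U)
  rw [ENNReal.toReal_mul, ENNReal.toReal_ofReal hc.le, ENNReal.toReal_ofReal hs]
  set s := ∑ t, (‖(D.moments P U).v t‖ ^ 2 + ((D.moments P U).Y t).trace)
  have k0' := mul_le_mul_of_nonneg_left k0 hD.γ_pos.le
  have kT' := mul_le_mul_of_nonneg_left kT hD.γ_pos.le
  have hle' := mul_le_mul_of_nonneg_left hle hc.le
  have hadd' : c * (D.sdpReal (D.moments P U) + D.γ * D.L / 2) = c * (s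
      + D.γ * gaussianKL (meanOf P) (covOf P) D.mα D.covα
      + D.γ * gaussianKL (meanOf (D.stateMeasure P U (Fin.last N)))
        (covOf (D.stateMeasure P U (Fin.last N))) D.mβ D.covβ) := congrArg (c * ·) hadd
  unfold Data.massCost Data.α Data.β
  linarith

/-- Every admissible pair costs at least the minimal mass cost, with equality only for the optimal
mass. -/
theorem Data.optimal_bound (hD : D.Valid)
    (hp : ∀ z, D.SDPFeasible z → (z.cov 0).PosDef → (z.cov (Fin.last N)).PosDef →
      p ≤ D.sdpReal z) {π₁ : Measure (E d)} {U : Fin N → Kernel (E d) (E d')}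
    (h : D.Admissible π₁ U) (hJ : D.J π₁ U ≠ ∞) :
    D.massCost p (D.massUpdate p) ≤ (D.J π₁ U).toReal ∧
      ((D.J π₁ U).toReal ≤ D.massCost p (D.massUpdate p) →
        π₁ Set.univ = ENNReal.ofReal (D.massUpdate p)) := by
  have hfin : IsFiniteMeasure π₁ := (h.memM2 0).1
  have hs := D.massUpdate_pos hD p
  by_cases hπ : π₁ = 0
  -- For the zero measure the divergences are `cα` and `cβ`, so the cost exceeds the minimum by at
  -- least `2 γ c⋆`.
  · suffices hlt : D.massCost p (D.massUpdate p) < (D.J π₁ U).toReal from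
      ⟨hlt.le, fun hle => absurd hlt hle.not_gt⟩
    obtain ⟨h1, h2, h3⟩ := (D.J_ne_top_iff hD).1 hJ
    have hlast : D.stateMeasure π₁ U (Fin.last N) = 0 := by
      have := D.stateMeasure_smul 0 (0 : Measure (E d)) U h.markov (Fin.last N)
      rw [zero_smul, zero_smul] at this
      rw [hπ, this]
    have fα : IsFiniteMeasure D.α := isFiniteMeasure_gaussianMeasure _ _ _
    have fβ : IsFiniteMeasure D.β := isFiniteMeasure_gaussianMeasure _ _ _
    rw [(D.toReal_J hD h1 h2 h3).2, hlast, D.massCost_massUpdate hD]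
    have e1 : (klDiv π₁ D.α).toReal = D.cα := by
      rw [hπ, klDiv_zero_left, Data.α, gaussianMeasure_univ, ENNReal.toReal_ofReal hD.cα_pos.le]
    have e2 : (klDiv 0 D.β).toReal = D.cβ := by
      rw [klDiv_zero_left, Data.β, gaussianMeasure_univ, ENNReal.toReal_ofReal hD.cβ_pos.le]
    rw [e1, e2]
    have := mul_pos hD.γ_pos hs
    have := ENNReal.toReal_nonneg (a := D.controlEnergy π₁ U)
    linarith
  · have hne : NeZero π₁ := ⟨hπ⟩
    have hpos : 0 < π₁ Set.univ := Measure.measure_univ_pos.2 hπ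
    set c := (π₁ Set.univ).toReal with hc
    have hc0 : 0 < c := ENNReal.toReal_pos hpos.ne' (measure_ne_top _ _)
    have hco : ENNReal.ofReal c = π₁ Set.univ := ENNReal.ofReal_toReal (measure_ne_top _ _)
    have hprob : IsProbabilityMeasure ((π₁ Set.univ)⁻¹ • π₁) := inferInstance
    have hsmul : π₁ = ENNReal.ofReal c • ((π₁ Set.univ)⁻¹ • π₁) := by
      rw [hco, smul_smul, ENNReal.mul_inv_cancel hpos.ne' (measure_ne_top _ _), one_smul]
    have hle : D.massCost p c ≤ (D.J π₁ U).toReal := by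
      have := Data.massCost_le_toReal_J hD hp (P := (π₁ Set.univ)⁻¹ • π₁) (U := U) hc0
        (hsmul ▸ h) (hsmul ▸ hJ)
      rwa [← hsmul] at this
    by_cases hcc : c = D.massUpdate p
    · exact ⟨hcc ▸ hle, fun _ => by rw [← hcc, hco]⟩
    · have hlt := (D.massCost_massUpdate_lt hD p hc0 hcc).trans_le hle
      exact ⟨hlt.le, fun h' => absurd hlt h'.not_gt⟩

end Value

end UDC

/-! ### The corollary on the optimal mass. -/

theorem mainTheorem12 {d d' N : ℕ} (D : UDC.Data d d' N) (hD : D.Valid) :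
    ∃ p : ℝ,
      -- the optimal value of the lifted SDP is the real number `p`, and it is attained
      D.sdpValue = (p : EReal) ∧
      (∃ z : UDC.SDPVar d d' N, D.IsSDPSolution z) ∧
      -- an optimal UDC solution exists, and every one has the mass given by the closed formula
      (∃ (π₁ : Measure (UDC.E d)) (U : Fin N → Kernel (UDC.E d) (UDC.E d')), D.IsOptimal π₁ U) ∧
      (∀ (π₁ : Measure (UDC.E d)) (U : Fin N → Kernel (UDC.E d) (UDC.E d')),
        D.IsOptimal π₁ U → π₁ Set.univ = ENNReal.ofReal (D.massUpdate p)) ∧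
      -- for each solution `z` of the SDP, the pseudo-inverse recovers gains and covariances,
      -- and any recovered ones, with the mass update, give a globally optimal UDC solution
      (∀ z : UDC.SDPVar d d' N, D.IsSDPSolution z →
        z.Recovers (fun t => z.S t * UDC.pinv (z.cov t.castSucc))
          (fun t => z.Y t - z.S t * UDC.pinv (z.cov t.castSucc) * (z.S t)ᵀ) ∧
        ∀ (K : Fin N → Matrix (Fin d') (Fin d) ℝ) (W : Fin N → Matrix (Fin d') (Fin d') ℝ),
          z.Recovers K W →
          D.IsOptimal (UDC.gaussianMeasure (D.massUpdate p) (z.m 0) (z.cov 0))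
            (fun t => UDC.affineGaussianPolicy (z.m t.castSucc) (z.v t) (K t) (W t))) := by
  obtain ⟨p, hval, ⟨z₀, hz₀⟩, hsol, hp⟩ := D.exists_sdpValue hD
  have hcost : ∀ z, D.IsSDPSolution z → ∀ K W, z.Recovers K W →
      D.Admissible (UDC.gaussianMeasure (D.massUpdate p) (z.m 0) (z.cov 0)) (z.policy K W) ∧
      D.J (UDC.gaussianMeasure (D.massUpdate p) (z.m 0) (z.cov 0)) (z.policy K W) ≠ ∞ ∧
      (D.J (UDC.gaussianMeasure (D.massUpdate p) (z.m 0) (z.cov 0)) (z.policy K W)).toReal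
        = D.massCost p (D.massUpdate p) := fun z hz K W hr => by
    obtain ⟨h0, hT, he⟩ := hsol z hz
    have := hr.toReal_J_eq hD hz.1 h0 hT (D.massUpdate_pos hD p)
    rwa [he] at this
  have hopt : ∀ z, D.IsSDPSolution z → ∀ K W, z.Recovers K W →
      D.IsOptimal (UDC.gaussianMeasure (D.massUpdate p) (z.m 0) (z.cov 0)) (z.policy K W) :=
    fun z hz K W hr => by
    obtain ⟨h1, h2, h3⟩ := hcost z hz K W hr
    refine ⟨h1, fun π' U' h' => ?_⟩
    by_cases hJ : D.J π' U' = ∞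
    · rw [hJ]
      exact le_top
    · rw [← ENNReal.toReal_le_toReal h2 hJ, h3]
      exact (UDC.Data.optimal_bound hD hp h' hJ).1
  have hr₀ := UDC.SDPVar.recovers_pinv hz₀.1
  refine ⟨p, hval, ⟨z₀, hz₀⟩, ⟨_, _, hopt z₀ hz₀ _ _ hr₀⟩, fun π₁ U h => ?_, fun z hz =>
    ⟨UDC.SDPVar.recovers_pinv hz.1, fun K W hr => hopt z hz K W hr⟩⟩
  obtain ⟨h1, h2, h3⟩ := hcost z₀ hz₀ _ _ hr₀
  -- Comparison with the pair recovered from `z₀` makes the cost finite and at most the minimal mass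
  -- cost; the equality case of `UDC.Data.optimal_bound` then fixes the mass.
  have hle := h.2 _ _ h1
  have hJ : D.J π₁ U ≠ ∞ := ne_top_of_le_ne_top h2 hle
  refine (UDC.Data.optimal_bound hD hp h.1 hJ).2 ?_
  rw [← h3]
  exact (ENNReal.toReal_le_toReal hJ h2).2 hle
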